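/- Let $R$ be a (commutative, Noetherian) Cohen–Macaulay local ring of Krull dimension $d$ having a canonical module $\omega$, i.e. a maximal Cohen–Macaulay $R$-module of type $1$ and of finite injective dimension. For an $R$-module $X$ write $X^\dagger=\operatorname{Hom}_R(X,\omega)$. Here a Cohen–Macaulay module is a nonzero finitely generated module $X$ with $\operatorname{depth}X=\dim X$, and it is maximal Cohen–Macaulay if moreover $\dim X=\dim R$; $\operatorname{Ext}^i_R$ with $i<0$ is zero. Let $M$ and $N$ be finitely generated $R$-modules with $N$ maximal Cohen–Macaulay, and let $n\ge 0$ be an integer. (i) If $\operatorname{Ext}^j_R(M,N)=0$ for all $j=1,\dots,d$, then there is an isomorphism of $R$-modules $M\otimes_R N^\dagger\cong \operatorname{Hom}_R(M,N)^\dagger$, and, if $M\neq 0$, the $R$-modules $M\otimes_R N^\dagger$ and $\operatorname{Hom}_R(M,N)$ are maximal Cohen–Macaulay. (ii) If $\operatorname{Ext}^j_R(M,N)=0$ for all $j=1,\dots,d+n$, then $$\operatorname{Ext}^d_R(\operatorname{Ext}^{d+n+1}_R(M,N),\omega)\cong \operatorname{Tor}^R_{n+1}(M,N^\dagger),$$ and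 $\operatorname{Tor}^R_i(M,N^\dagger)=0$ for all $i=1,\dots,n$. Moreover, there exists an exact sequence $$\operatorname{Tor}^R_{n+3}(M,N^\dagger)\to \operatorname{Ext}^{d-2}_R(\operatorname{Ext}^{d+n+1}_R(M,N),\omega)\to \operatorname{Ext}^{d}_R(\operatorname{Ext}^{d+n+2}_R(M,N),\omega)\to \operatorname{Tor}^R_{n+2}(M,N^\dagger)\to \operatorname{Ext}^{d-1}_R(\operatorname{Ext}^{d+n+1}_R(M,N),\omega)\to 0.$$ (iii) If $\operatorname{Tor}^R_j(M,N^\dagger)=0$ for all $j=1,\dots,d+n$, then $$\operatorname{Tor}^R_{d+n+1}(M,N^\dagger)^\dagger\cong \operatorname{Ext}^{d+n+1}_R(M,N),\qquad \operatorname{Ext}^i_R(M\otimes_R N^\dagger,\omega)\cong \operatorname{Ext}^i_R(M,N)\quad\text{for all } i=0,\dots,d,$$ and $\operatorname{Ext}^k_R(M,N)=0$ for all $k=d+1,\dots,d+n$. Moreover, there exists an exact sequence $$0\to \operatorname{Ext}^1_R(\operatorname{Tor}^R_{d+n+1}(M,N^\dagger),\omega)\to \operatorname{Ext}^{d+n+2}_R(M,N)\to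 \operatorname{Tor}^R_{d+n+2}(M,N^\dagger)^\dagger\to \operatorname{Ext}^2_R(\operatorname{Tor}^R_{d+n+1}(M,N^\dagger),\omega)\to \operatorname{Ext}^{d+n+3}_R(M,N).$$ -/

import Mathlib

open CategoryTheory
open scoped TensorProduct

universe u

noncomputable section

/-- The depth of a module over a local ring: the supremum of the lengths of the `M`-regular
sequences contained in the maximal ideal. -/
def moduleDepth (R : Type u) [CommRing R] [IsLocalRing R]
    (M : Type u) [AddCommGroup M] [Module R M] : ℕ∞ :=
  ⨆ rs : {rs : List R // (∀ r ∈ rs, r ∈ IsLocalRing.maximalIdeal R) ∧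
    RingTheory.Sequence.IsRegular M rs}, (rs.1.length : ℕ∞)

/-- Cohen-Macaulay modules over a (Noetherian) local ring: nonzero, finitely generated, and with
depth equal to the Krull dimension. -/
structure IsCohenMacaulayModule (R : Type u) [CommRing R] [IsLocalRing R]
    (M : Type u) [AddCommGroup M] [Module R M] : Prop where
  nontrivial : Nontrivial M
  finite : Module.Finite R M
  depth_eq : (moduleDepth R M : WithBot ℕ∞) = Module.supportDim R M

/-- Maximal Cohen-Macaulay modules: Cohen-Macaulay modules of dimension `dim R`. -/
structure IsMaximalCohenMacaulay (R : Type u) [CommRing R] [IsLocalRing R]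
    (M : Type u) [AddCommGroup M] [Module R M] : Prop extends IsCohenMacaulayModule R M where
  dim_eq : Module.supportDim R M = ringKrullDim R

/-- A Cohen-Macaulay local ring: a Noetherian local ring which is Cohen-Macaulay as a module over
itself. -/
structure IsCohenMacaulayLocalRing (R : Type u) [CommRing R] [IsLocalRing R] : Prop where
  noetherian : IsNoetherianRing R
  cohenMacaulay : IsCohenMacaulayModule R R

/-- The `R`-module `Ext^n_R(M, N)`. -/
abbrev ExtModule (R : Type u) [CommRing R] (M N : Type u) [AddCommGroup M] [Module R M]
    [AddCommGroup N] [Module R N] (n : ℕ) : Type u :=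
  Abelian.Ext.{u} (ModuleCat.of R M) (ModuleCat.of R N) n

/-- The `R`-module `Ext^i_R(M, N)` for an arbitrary integer `i`, zero for `i < 0`. -/
def extInt (R : Type u) [CommRing R] (M N : Type u) [AddCommGroup M] [Module R M]
    [AddCommGroup N] [Module R N] : ℤ → ModuleCat.{u} R
  | Int.ofNat n => ModuleCat.of R (ExtModule R M N n)
  | Int.negSucc _ => ModuleCat.of R PUnit.{u + 1}

/-- The `R`-module `Tor_n^R(M, N)`, the value at `M` of the `n`-th left derived functor
of `- ⊗ N`. -/
abbrev TorModule (R : Type u) [CommRing R] (M N : Type u) [AddCommGroup M] [Module R M]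
    [AddCommGroup N] [Module R N] (n : ℕ) : Type u :=
  ((Tor' (ModuleCat.{u} R) n).obj (ModuleCat.of R M)).obj (ModuleCat.of R N)

/-- Canonical modules of a Cohen-Macaulay local ring `R`: maximal Cohen-Macaulay modules of finite
injective dimension and of type one, that is, with `Ext^d_R(k, ω)` of dimension one over the
residue field `k`, where `d = depth ω = dim R`. -/
structure IsCanonicalModule (R : Type u) [CommRing R] [IsLocalRing R]
    (ω : Type u) [AddCommGroup ω] [Module R ω] : Prop
    extends IsMaximalCohenMacaulay R ω where
  finite_injectiveDimension : ∃ n : ℕ, HasInjectiveDimensionLE (ModuleCat.of R ω) n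
  type_one : ∃ d : ℕ, moduleDepth R ω = d ∧
    Nonempty (ExtModule R (IsLocalRing.ResidueField R) ω d ≃ₗ[R] IsLocalRing.ResidueField R)

/-- The dual `M^† = Hom_R(M, ω)` of `M` with respect to `ω`. -/
abbrev CanonicalDual (R : Type u) [CommRing R] (ω M : Type u) [AddCommGroup ω] [Module R ω]
    [AddCommGroup M] [Module R M] : Type u :=
  M →ₗ[R] ω

end

/-! Let `F` be a resolution of `M` by finite free modules and `G = Hom(F, N)`, a complex with
cohomology `Ext(M, N)`. Since each `F_i` is finite free, `Hom(G, ω) ≅ F ⊗ N†`, a complex with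
homology `Tor(M, N†)`. The terms of `G` are finite sums of copies of `N`, so they have no higher
`Ext` into `ω`. Hence `Ext(H(G), ω)` converges to `H(Hom(G, ω))`, and all of (i) and (ii) comes from
this, because `Ext^p(-, ω) = 0` for `p > d`.

The spectral sequence is avoided by cutting `G` into maps `u : C → P` with `C = G^{q+1} / im G^q`
and `P = G^{q+2}`. The kernel of `u` is `Ext^{q+1}(M, N)` and its cokernel is the next `C`. As `P`
is acyclic, `exists_longExact` links `Ext(ker u, ω)`, `Ext(coker u, ω)` and `Ext(C, ω)`. In degree
`0` one must replace `Hom(C, ω)` by its quotient by the maps that extend to `P`; this quotient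
(`stable` in degree `0`) is the homology of the dual complex, that is, `Tor_{q+1}(M, N†)`. Where a
kernel vanishes, the sequence becomes a dimension shift; after more than `d` shifts everything is
zero, and at the first nonzero kernel the sequence gives the stated isomorphisms and exact
sequences.

Part (iii) is the same argument for the complex `F ⊗ N†`, whose dual is `Hom(F, N††) ≅ Hom(F, N)`.

The local algebra has to supply four facts. A finitely generated module of finite injective
dimension receives no `Ext` above the depth of `R` (`subsingleton_ext_of_depth_lt`). If `N` is
maximal Cohen–Macaulay then `Ext^p(N, ω) = 0` for `p > 0` (`subsingleton_of_isWeaklyRegular`). Depth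
passes to `Hom(M, N)` (`isWeaklyRegular_hom`). Finally `N†† ≅ N`: part (i) for the pair `(N, ω)`
gives `N ⊗ End ω ≅ N††`, and `End ω ≅ R` (`IsCanonicalModule.hasScalarEnd`) by reduction modulo a
regular sequence to a length count over an Artinian ring. -/

namespace ExtModule

/-! ### Contravariant long exact sequences of `Ext`. -/

noncomputable section

variable {R : Type u} [CommRing R]
  {A B C Y : Type u} [AddCommGroup A] [Module R A] [AddCommGroup B] [Module R B]
  [AddCommGroup C] [Module R C] [AddCommGroup Y] [Module R Y]

/-- The map `Ext^n(B, Y) → Ext^n(A, Y)` induced by `f : A → B`. -/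
def pre (Y : Type u) [AddCommGroup Y] [Module R Y] (f : A →ₗ[R] B) (n : ℕ) :
    ExtModule R B Y n →ₗ[R] ExtModule R A Y n :=
  (Abelian.Ext.mk₀ (ModuleCat.ofHom f)).precompOfLinear R (ModuleCat.of R Y) (zero_add n)

/-- Linear maps as elements of `Ext^0`. -/
def zeroEquiv (A Y : Type u) [AddCommGroup A] [Module R A] [AddCommGroup Y] [Module R Y] :
    ExtModule R A Y 0 ≃ₗ[R] (A →ₗ[R] Y) :=
  Abelian.Ext.linearEquiv₀.trans ModuleCat.homLinearEquiv

lemma zeroEquiv_symm_apply (φ : A →ₗ[R] Y) :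
    (zeroEquiv A Y).symm φ = Abelian.Ext.mk₀ (ModuleCat.ofHom φ) := rfl

lemma pre_zeroEquiv_symm (f : A →ₗ[R] B) (φ : B →ₗ[R] Y) :
    pre Y f 0 ((zeroEquiv B Y).symm φ) = (zeroEquiv A Y).symm (φ ∘ₗ f) := by
  simp [pre, zeroEquiv_symm_apply]

lemma zeroEquiv_pre (f : A →ₗ[R] B) (x : ExtModule R B Y 0) :
    zeroEquiv A Y (pre Y f 0 x) = zeroEquiv B Y x ∘ₗ f := by
  obtain ⟨φ, rfl⟩ := (zeroEquiv B Y).symm.surjective x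
  rw [pre_zeroEquiv_symm]; simp

lemma pre_comp (f : A →ₗ[R] B) (g : B →ₗ[R] C) (n : ℕ) (x : ExtModule R C Y n) :
    pre Y (g ∘ₗ f) n x = pre Y f n (pre Y g n x) := by
  simp [pre, ModuleCat.ofHom_comp]

lemma pre_id (n : ℕ) (x : ExtModule R A Y n) : pre Y (LinearMap.id : A →ₗ[R] A) n x = x := by
  simp [pre]

lemma pre_smul_id (r : R) (n : ℕ) (x : ExtModule R A Y n) :
    pre Y (r • (LinearMap.id : A →ₗ[R] A)) n x = r • x := by
  have : ModuleCat.ofHom (r • (LinearMap.id : A →ₗ[R] A)) = r • 𝟙 (ModuleCat.of R A) := rfl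
  simp [pre, this, Abelian.Ext.mk₀_smul]

/-- `Ext^n(-, Y)` of a linear equivalence. -/
def congrLeft (e : A ≃ₗ[R] B) (n : ℕ) : ExtModule R A Y n ≃ₗ[R] ExtModule R B Y n :=
  LinearEquiv.ofLinearMap (pre Y e.symm.toLinearMap n) (pre Y e.toLinearMap n)
    (by ext x; simp [← pre_comp, pre_id]) (by ext x; simp [← pre_comp, pre_id])

lemma subsingleton_of_subsingleton [Subsingleton A] (n : ℕ) :
    Subsingleton (ExtModule R A Y n) := by
  refine ⟨fun x y => ?_⟩
  rw [← pre_id n x, ← pre_id n y, show (LinearMap.id : A →ₗ[R] A) = (0 : R) • LinearMap.id from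
    Subsingleton.elim _ _, pre_smul_id, pre_smul_id, zero_smul, zero_smul]

lemma subsingleton_of_projective [Module.Projective R A] (n : ℕ) (hn : 1 ≤ n) :
    Subsingleton (ExtModule R A Y n) := by
  obtain ⟨n, rfl⟩ := Nat.exists_eq_add_of_le' hn
  exact subsingleton_of_forall_eq 0 fun x => Abelian.Ext.eq_zero_of_projective x

section LongExact

variable (f : A →ₗ[R] B) (g : B →ₗ[R] C) (hf : Function.Injective f)
  (hfg : Function.Exact f g) (hg : Function.Surjective g)

include hf hfg hg in
lemma shortExact :
    (ModuleCat.shortComplexOfCompEqZero f g hfg.linearMap_comp_eq_zero).ShortExact :=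
  ModuleCat.shortComplex_shortExact _ hfg hf hg

/-- The connecting map `Ext^n(A, Y) → Ext^{n+1}(C, Y)` of a short exact sequence
`0 → A → B → C → 0`. -/
def δ (Y : Type u) [AddCommGroup Y] [Module R Y] (n : ℕ) :
    ExtModule R A Y n →ₗ[R] ExtModule R C Y (n + 1) :=
  (shortExact f g hf hfg hg).extClass.precompOfLinear R (ModuleCat.of R Y) (add_comm 1 n)

include hf hfg hg

lemma exact_pre_pre (n : ℕ) : Function.Exact (pre Y g n) (pre Y f n) := by
  have := Abelian.Ext.contravariant_sequence_exact₂' (shortExact f g hf hfg hg)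
    (ModuleCat.of R Y) n
  rw [ShortComplex.ab_exact_iff_function_exact] at this
  exact this

lemma exact_pre_δ (n : ℕ) : Function.Exact (pre Y f n) (δ f g hf hfg hg Y n) := by
  have := Abelian.Ext.contravariant_sequence_exact₁' (shortExact f g hf hfg hg)
    (ModuleCat.of R Y) n (n + 1) (add_comm 1 n)
  rw [ShortComplex.ab_exact_iff_function_exact] at this
  exact this

lemma exact_δ_pre (n : ℕ) : Function.Exact (δ f g hf hfg hg Y n) (pre Y g (n + 1)) := by
  have := Abelian.Ext.contravariant_sequence_exact₃' (shortExact f g hf hfg hg)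
    (ModuleCat.of R Y) n (n + 1) (add_comm 1 n)
  rw [ShortComplex.ab_exact_iff_function_exact] at this
  exact this

lemma δ_injective (n : ℕ) (h : Subsingleton (ExtModule R B Y n)) :
    Function.Injective (δ f g hf hfg hg Y n) := by
  rw [injective_iff_map_eq_zero]
  intro x hx
  obtain ⟨y, rfl⟩ := (exact_pre_δ f g hf hfg hg n x).mp hx
  rw [Subsingleton.elim y 0, map_zero]

lemma δ_surjective (n : ℕ) (h : Subsingleton (ExtModule R B Y (n + 1))) :
    Function.Surjective (δ f g hf hfg hg Y n) := fun x =>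
  (exact_δ_pre f g hf hfg hg n x).mp (Subsingleton.elim _ _)

lemma subsingleton_middle (n : ℕ) (hA : Subsingleton (ExtModule R A Y n))
    (hC : Subsingleton (ExtModule R C Y n)) : Subsingleton (ExtModule R B Y n) := by
  refine subsingleton_of_forall_eq 0 fun x => ?_
  obtain ⟨y, rfl⟩ := (exact_pre_pre (Y := Y) f g hf hfg hg n x).mp (Subsingleton.elim _ _)
  rw [Subsingleton.elim y 0, map_zero]

lemma subsingleton_left (n : ℕ) (hB : Subsingleton (ExtModule R B Y n))
    (hC : Subsingleton (ExtModule R C Y (n + 1))) : Subsingleton (ExtModule R A Y n) := by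
  refine subsingleton_of_forall_eq 0 fun x => ?_
  obtain ⟨y, rfl⟩ := (exact_pre_δ (Y := Y) f g hf hfg hg n x).mp (Subsingleton.elim _ _)
  rw [Subsingleton.elim y 0, map_zero]

lemma subsingleton_right (n : ℕ) (hA : Subsingleton (ExtModule R A Y n))
    (hB : Subsingleton (ExtModule R B Y (n + 1))) : Subsingleton (ExtModule R C Y (n + 1)) := by
  refine subsingleton_of_forall_eq 0 fun x => ?_
  obtain ⟨y, rfl⟩ := (exact_δ_pre (Y := Y) f g hf hfg hg n x).mp (Subsingleton.elim _ _)
  rw [Subsingleton.elim y 0, map_zero]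

lemma pre_surjective (n : ℕ) (hC : Subsingleton (ExtModule R C Y (n + 1))) :
    Function.Surjective (pre Y f n) := fun x =>
  (exact_pre_δ f g hf hfg hg n x).mp (Subsingleton.elim _ _)

end LongExact

end

end ExtModule

/-! ### The long exact sequence of a map into an acyclic module. -/

noncomputable section

lemma LinearMap.exists_comp_eq_of_ker_le {R S T Z : Type*} [Ring R] [AddCommGroup S] [Module R S]
    [AddCommGroup T] [Module R T] [AddCommGroup Z] [Module R Z] (s : S →ₗ[R] T)
    (hs : Function.Surjective s) (h : S →ₗ[R] Z) (hle : LinearMap.ker s ≤ LinearMap.ker h) :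
    ∃ a : T →ₗ[R] Z, ∀ x, a (s x) = h x := by
  refine ⟨(LinearMap.ker s).liftQ h hle ∘ₗ (s.quotKerEquivOfSurjective hs).symm.toLinearMap,
    fun x => ?_⟩
  have : (s.quotKerEquivOfSurjective hs).symm (s x) = Submodule.Quotient.mk x := by
    rw [LinearEquiv.symm_apply_eq]; rfl
  simp [this]

namespace ExtModule

variable {R : Type u} [CommRing R]
  {C P C' Y : Type u} [AddCommGroup C] [Module R C] [AddCommGroup P] [Module R P]
  [AddCommGroup C'] [Module R C'] [AddCommGroup Y] [Module R Y]

/-- The module `Ext^p(C, Y)` for positive `p`, and the cokernel of `Hom(P, Y) → Hom(C, Y)` for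
`p = 0`, where `u : C → P`. -/
def stable (Y : Type u) [AddCommGroup Y] [Module R Y] (u : C →ₗ[R] P) : ℕ → ModuleCat.{u} R
  | 0 => ModuleCat.of R ((C →ₗ[R] Y) ⧸ LinearMap.range (LinearMap.lcomp R Y u))
  | p + 1 => ModuleCat.of R (ExtModule R C Y (p + 1))

/-- The class of a linear map in the cokernel `stable Y u 0`. -/
def stableMk (Y : Type u) [AddCommGroup Y] [Module R Y] (u : C →ₗ[R] P) :
    (C →ₗ[R] Y) →ₗ[R] stable Y u 0 :=
  (LinearMap.range (LinearMap.lcomp R Y u)).mkQ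

/-- In positive degrees `stable` is `Ext`. -/
def stableSucc (Y : Type u) [AddCommGroup Y] [Module R Y] (u : C →ₗ[R] P) (p : ℕ) :
    ExtModule R C Y (p + 1) ≃ₗ[R] stable Y u (p + 1) :=
  LinearEquiv.refl R _

lemma stableMk_surjective (u : C →ₗ[R] P) : Function.Surjective (stableMk Y u) :=
  Submodule.mkQ_surjective _

lemma stableMk_eq_zero_iff (u : C →ₗ[R] P) (φ : C →ₗ[R] Y) :
    stableMk Y u φ = 0 ↔ ∃ ψ : P →ₗ[R] Y, ψ ∘ₗ u = φ :=
  Submodule.Quotient.mk_eq_zero _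

/-- For a four-term exact sequence `0 → ker u → C → P → C' → 0` with `P` acyclic for `Hom(-, Y)`,
the groups `Ext^p(C', Y)` and `stable Y u p` fit into a long exact sequence with
`Ext^p(ker u, Y)`. -/
theorem exists_longExact (u : C →ₗ[R] P) (π : P →ₗ[R] C') (huπ : Function.Exact u π)
    (hπ : Function.Surjective π) (hP : ∀ p, 1 ≤ p → Subsingleton (ExtModule R P Y p)) :
    ∃ (a : ∀ p, ExtModule R C' Y (p + 1) →ₗ[R] stable Y u p)
      (b : ∀ p, stable Y u p →ₗ[R] ExtModule R (LinearMap.ker u) Y p)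
      (c : ∀ p, ExtModule R (LinearMap.ker u) Y p →ₗ[R] ExtModule R C' Y (p + 2)),
      Function.Injective (a 0) ∧ ∀ p, Function.Exact (a p) (b p) ∧ Function.Exact (b p) (c p) ∧
        Function.Exact (c p) (a (p + 1)) := by
  -- Split at the image: `0 → ker u → C → im u → 0` and `0 → im u → P → C' → 0`. The result is the
  -- long exact sequence of the first, with `Ext^p(im u, Y)` replaced by `Ext^{p+1}(C', Y)` through
  -- the connecting map of the second. That map is bijective for `p ≥ 1` but only surjective for `p
  -- = 0`.
  let ι : LinearMap.ker u →ₗ[R] C := (LinearMap.ker u).subtype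
  let v : C →ₗ[R] LinearMap.range u := u.rangeRestrict
  let j : LinearMap.range u →ₗ[R] P := (LinearMap.range u).subtype
  have hι : Function.Injective ι := Subtype.val_injective
  have hj : Function.Injective j := Subtype.val_injective
  have hv : Function.Surjective v := u.surjective_rangeRestrict
  have hιv : Function.Exact ι v := fun x => by simp [ι, v, Subtype.ext_iff]
  have hjπ : Function.Exact j π := fun x => by
    rw [huπ x]; simp [j]
  have hjv : j ∘ₗ v = u := rfl
  let d₁ := fun p => δ ι v hι hιv hv Y p
  let d₂ := fun p => δ j π hj hjπ hπ Y p
  have d₂surj : ∀ p, Function.Surjective (d₂ p) := fun p =>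
    δ_surjective j π hj hjπ hπ p (hP _ (by lia))
  have d₂inj : ∀ p, 1 ≤ p → Function.Injective (d₂ p) := fun p hp =>
    δ_injective j π hj hjπ hπ p (hP _ hp)
  let h : ∀ p, ExtModule R (LinearMap.range u) Y p →ₗ[R] stable Y u p := fun p =>
    match p with
    | 0 => stableMk Y u ∘ₗ LinearMap.lcomp R Y v ∘ₗ (zeroEquiv _ _).toLinearMap
    | p + 1 => (stableSucc Y u p).toLinearMap ∘ₗ pre Y v (p + 1)
  have h_zero : ∀ x, h 0 x = stableMk Y u (zeroEquiv _ _ x ∘ₗ v) := fun x => rfl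
  have h_succ : ∀ p x, h (p + 1) x = stableSucc Y u p (pre Y v (p + 1) x) := fun p x => rfl
  -- For `p = 0` the kernel of `d₂` consists of the maps on `im u` that extend to `P`, exactly what
  -- the quotient in degree `0` kills.
  have hle : ∀ p, LinearMap.ker (d₂ p) ≤ LinearMap.ker (h p) := by
    rintro (_ | p) x hx
    · obtain ⟨y, rfl⟩ := (exact_pre_δ j π hj hjπ hπ 0 x).mp hx
      rw [LinearMap.mem_ker, h_zero, stableMk_eq_zero_iff]
      exact ⟨zeroEquiv _ _ y, by rw [zeroEquiv_pre, LinearMap.comp_assoc, hjv]⟩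
    · rw [LinearMap.ker_eq_bot.mpr (d₂inj (p + 1) (by lia))] at hx
      rw [(Submodule.mem_bot R).mp hx]; exact Submodule.zero_mem _
  choose a ha using fun p => LinearMap.exists_comp_eq_of_ker_le (d₂ p) (d₂surj p) (h p) (hle p)
  obtain ⟨b₀, hb₀⟩ := LinearMap.exists_comp_eq_of_ker_le (stableMk Y u) (stableMk_surjective u)
      (pre Y ι 0 ∘ₗ (zeroEquiv _ _).symm.toLinearMap) (by
        intro φ hφ
        obtain ⟨ψ, rfl⟩ := (stableMk_eq_zero_iff u φ).mp hφ
        have : (ψ ∘ₗ u) ∘ₗ ι = 0 := by ext x; simp [ι]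
        rw [LinearMap.mem_ker, LinearMap.comp_apply, LinearEquiv.coe_coe, pre_zeroEquiv_symm,
          this, map_zero])
  simp only [LinearMap.comp_apply, LinearEquiv.coe_coe] at hb₀
  let b : ∀ p, stable Y u p →ₗ[R] ExtModule R (LinearMap.ker u) Y p := fun p =>
    match p with
    | 0 => b₀
    | p + 1 => pre Y ι (p + 1) ∘ₗ (stableSucc Y u p).symm.toLinearMap
  have b_succ : ∀ p x, b (p + 1) (stableSucc Y u p x) = pre Y ι (p + 1) x := fun p x => rfl
  refine ⟨a, b, fun p => d₂ (p + 1) ∘ₗ d₁ p, ?_, fun p => ⟨?_, ?_, ?_⟩⟩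
  · rw [injective_iff_map_eq_zero]
    intro x hx
    obtain ⟨β, rfl⟩ := d₂surj 0 x
    rw [ha, h_zero, stableMk_eq_zero_iff] at hx
    obtain ⟨ψ, hψ⟩ := hx
    refine (exact_pre_δ j π hj hjπ hπ 0 β).mpr ⟨(zeroEquiv _ _).symm ψ, ?_⟩
    rw [pre_zeroEquiv_symm, LinearEquiv.symm_apply_eq]
    ext ⟨_, x, rfl⟩
    exact LinearMap.congr_fun hψ x
  · intro x
    rcases p with _ | p
    · obtain ⟨φ, rfl⟩ := stableMk_surjective u x
      change b₀ _ = 0 ↔ _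
      rw [hb₀, exact_pre_pre ι v hι hιv hv 0]
      constructor
      · rintro ⟨β, hβ⟩
        refine ⟨d₂ 0 β, ?_⟩
        rw [ha, h_zero, ← zeroEquiv_pre, hβ, LinearEquiv.apply_symm_apply]
      · rintro ⟨y, hy⟩
        obtain ⟨β, rfl⟩ := d₂surj 0 y
        rw [ha, h_zero, eq_comm, ← sub_eq_zero, ← map_sub, stableMk_eq_zero_iff] at hy
        obtain ⟨ψ, hψ⟩ := hy
        -- `β` and `φ` agree only up to a map that extends to `P`; the restriction of that extension
        -- `ψ` corrects `β`.
        refine ⟨β + pre Y j 0 ((zeroEquiv _ _).symm ψ), ?_⟩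
        rw [map_add, pre_zeroEquiv_symm, pre_zeroEquiv_symm, LinearMap.comp_assoc, hjv,
          LinearEquiv.eq_symm_apply, map_add, zeroEquiv_pre, LinearEquiv.apply_symm_apply, hψ]
        abel
    · obtain ⟨x, rfl⟩ := (stableSucc Y u p).surjective x
      rw [b_succ, exact_pre_pre ι v hι hιv hv (p + 1)]
      constructor
      · rintro ⟨β, rfl⟩
        exact ⟨d₂ (p + 1) β, by rw [ha, h_succ]⟩
      · rintro ⟨y, hy⟩
        obtain ⟨β, rfl⟩ := d₂surj (p + 1) y
        rw [ha, h_succ] at hy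
        exact ⟨β, (stableSucc Y u p).injective hy⟩
  · intro x
    rw [LinearMap.comp_apply, map_eq_zero_iff _ (d₂inj (p + 1) (by lia)),
      exact_pre_δ ι v hι hιv hv p]
    rcases p with _ | p
    · constructor
      · rintro ⟨y, rfl⟩
        exact ⟨stableMk Y u (zeroEquiv _ _ y), (hb₀ _).trans (by rw [LinearEquiv.symm_apply_apply])⟩
      · rintro ⟨y, rfl⟩
        obtain ⟨φ, rfl⟩ := stableMk_surjective u y
        exact ⟨_, (hb₀ _).symm⟩
    · constructor
      · rintro ⟨y, rfl⟩
        exact ⟨stableSucc Y u p y, b_succ _ _⟩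
      · rintro ⟨y, rfl⟩
        obtain ⟨y, rfl⟩ := (stableSucc Y u p).surjective y
        exact ⟨y, (b_succ _ _).symm⟩
  · intro x
    obtain ⟨β, rfl⟩ := d₂surj (p + 1) x
    rw [ha, h_succ, LinearEquiv.map_eq_zero_iff, exact_δ_pre ι v hι hιv hv p]
    constructor
    · rintro ⟨y, rfl⟩
      exact ⟨y, rfl⟩
    · rintro ⟨y, hy⟩
      exact ⟨y, d₂inj (p + 1) (by lia) hy⟩

end ExtModule
end

/-! ### Dimension shifting along a chain of such maps. -/

noncomputable section

section Congr

variable {R : Type*} [Ring R] {A₁ A₂ A₃ A₄ A₅ B₁ B₂ B₃ B₄ B₅ : Type*}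
  [AddCommGroup A₁] [Module R A₁] [AddCommGroup A₂] [Module R A₂] [AddCommGroup A₃] [Module R A₃]
  [AddCommGroup A₄] [Module R A₄] [AddCommGroup A₅] [Module R A₅]
  [AddCommGroup B₁] [Module R B₁] [AddCommGroup B₂] [Module R B₂] [AddCommGroup B₃] [Module R B₃]
  [AddCommGroup B₄] [Module R B₄] [AddCommGroup B₅] [Module R B₅]

lemma Function.Exact.linearEquiv_conj {f : A₁ →ₗ[R] A₂} {g : A₂ →ₗ[R] A₃}
    (h : Function.Exact f g) (e₁ : A₁ ≃ₗ[R] B₁) (e₂ : A₂ ≃ₗ[R] B₂) (e₃ : A₃ ≃ₗ[R] B₃) :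
    Function.Exact (e₂.toLinearMap ∘ₗ f ∘ₗ e₁.symm.toLinearMap)
      (e₃.toLinearMap ∘ₗ g ∘ₗ e₂.symm.toLinearMap) := by
  intro y
  simp only [LinearMap.comp_apply, LinearEquiv.coe_coe, LinearEquiv.map_eq_zero_iff, h _,
    Set.mem_range]
  constructor
  · rintro ⟨x, hx⟩
    exact ⟨e₁ x, by simp [hx]⟩
  · rintro ⟨x, rfl⟩
    exact ⟨e₁.symm x, by simp⟩

/-- Exact sequences with five terms are invariant under isomorphism. -/
lemma exists_exact_of_linearEquiv (e₁ : A₁ ≃ₗ[R] B₁) (e₂ : A₂ ≃ₗ[R] B₂) (e₃ : A₃ ≃ₗ[R] B₃)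
    (e₄ : A₄ ≃ₗ[R] B₄) (e₅ : A₅ ≃ₗ[R] B₅) (f₁ : A₁ →ₗ[R] A₂) (f₂ : A₂ →ₗ[R] A₃)
    (f₃ : A₃ →ₗ[R] A₄) (f₄ : A₄ →ₗ[R] A₅) (h₁ : Function.Exact f₁ f₂) (h₂ : Function.Exact f₂ f₃)
    (h₃ : Function.Exact f₃ f₄) :
    ∃ (g₁ : B₁ →ₗ[R] B₂) (g₂ : B₂ →ₗ[R] B₃) (g₃ : B₃ →ₗ[R] B₄) (g₄ : B₄ →ₗ[R] B₅),
      Function.Exact g₁ g₂ ∧ Function.Exact g₂ g₃ ∧ Function.Exact g₃ g₄ ∧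
      (Function.Injective f₁ → Function.Injective g₁) ∧
      (Function.Surjective f₄ → Function.Surjective g₄) :=
  ⟨_, _, _, _, h₁.linearEquiv_conj e₁ e₂ e₃, h₂.linearEquiv_conj e₂ e₃ e₄,
    h₃.linearEquiv_conj e₃ e₄ e₅,
    fun h => e₂.injective.comp (h.comp e₁.symm.injective),
    fun h => e₅.surjective.comp (h.comp e₄.symm.surjective)⟩

end Congr

variable {R : Type u} [CommRing R]

lemma extInt_congr {X X' Y : Type u} [AddCommGroup X] [Module R X] [AddCommGroup X'] [Module R X']
    [AddCommGroup Y] [Module R Y] (e : X ≃ₗ[R] X') (z : ℤ) :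
    Nonempty (extInt R X Y z ≃ₗ[R] extInt R X' Y z) := by
  match z with
  | Int.ofNat p => exact ⟨ExtModule.congrLeft e p⟩
  | Int.negSucc p => exact ⟨LinearEquiv.refl R _⟩

lemma extInt_subsingleton_of_neg {X Y : Type u} [AddCommGroup X] [Module R X]
    [AddCommGroup Y] [Module R Y] {z : ℤ} (hz : z < 0) : Subsingleton (extInt R X Y z) := by
  match z with
  | Int.negSucc p => exact inferInstanceAs (Subsingleton PUnit)

lemma extInt_equiv {X Y : Type u} [AddCommGroup X] [Module R X]
    [AddCommGroup Y] [Module R Y] {z : ℤ} {p : ℕ} (hz : z = p) :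
    Nonempty (ExtModule R X Y p ≃ₗ[R] extInt R X Y z) := by
  subst hz; exact ⟨LinearEquiv.refl R _⟩

namespace ExtModule

variable {Y : Type u} [AddCommGroup Y] [Module R Y]

section FourTerm

variable {C P C' : Type u} [AddCommGroup C] [Module R C] [AddCommGroup P] [Module R P]
  [AddCommGroup C'] [Module R C'] (u : C →ₗ[R] P) (π : P →ₗ[R] C') (huπ : Function.Exact u π)
  (hπ : Function.Surjective π) (hP : ∀ p, 1 ≤ p → Subsingleton (ExtModule R P Y p))

include huπ hπ hP

/-- With no kernel every third term of the long exact sequence vanishes, so `a p` is bijective. For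
`p = 0` there is no preceding term, and injectivity is a separate clause of `exists_longExact`. -/
lemma ext_equiv_stable (hH : Subsingleton (LinearMap.ker u)) (p : ℕ) :
    Nonempty (ExtModule R C' Y (p + 1) ≃ₗ[R] stable Y u p) := by
  obtain ⟨a, b, c, ha, h⟩ := exists_longExact (Y := Y) u π huπ hπ hP
  have hs : ∀ q, Subsingleton (ExtModule R (LinearMap.ker u) Y q) :=
    fun q => subsingleton_of_subsingleton q
  refine ⟨LinearEquiv.ofBijective (a p) ⟨?_, fun x => ((h p).1 x).mp (Subsingleton.elim _ _)⟩⟩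
  rcases p with _ | p
  · exact ha
  · rw [injective_iff_map_eq_zero]
    intro x hx
    obtain ⟨y, rfl⟩ := ((h p).2.2 x).mp hx
    rw [Subsingleton.elim y 0, map_zero]

lemma stable_equiv_ext_ker (p : ℕ) (h₁ : Subsingleton (ExtModule R C' Y (p + 1)))
    (h₂ : Subsingleton (ExtModule R C' Y (p + 2))) :
    Nonempty (stable Y u p ≃ₗ[R] ExtModule R (LinearMap.ker u) Y p) := by
  obtain ⟨a, b, c, ha, h⟩ := exists_longExact (Y := Y) u π huπ hπ hP
  refine ⟨LinearEquiv.ofBijective (b p) ⟨?_, fun x => ((h p).2.1 x).mp (Subsingleton.elim _ _)⟩⟩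
  rw [injective_iff_map_eq_zero]
  intro x hx
  obtain ⟨y, rfl⟩ := ((h p).1 x).mp hx
  rw [Subsingleton.elim y 0, map_zero]

end FourTerm

section Ascending

variable {C P : ℕ → Type u} [∀ q, AddCommGroup (C q)] [∀ q, Module R (C q)]
  [∀ q, AddCommGroup (P q)] [∀ q, Module R (P q)]
  (u : ∀ q, C q →ₗ[R] P q) (π : ∀ q, P q →ₗ[R] C (q + 1))
  (huπ : ∀ q, Function.Exact (u q) (π q)) (hπ : ∀ q, Function.Surjective (π q))
  (hP : ∀ q p, 1 ≤ p → Subsingleton (ExtModule R (P q) Y p))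

include huπ hπ hP

/-- Each vanishing kernel trades one step along the chain for one cohomological degree. -/
lemma stable_equiv_stable_add (k : ℕ) : ∀ q q' p p' : ℕ, q' = q + k → p' = p + k →
    (∀ j, q ≤ j → j < q' → Subsingleton (LinearMap.ker (u j))) →
    Nonempty (stable Y (u q') p' ≃ₗ[R] stable Y (u q) p) := by
  induction k with
  | zero =>
    rintro q q' p p' rfl rfl -
    exact ⟨LinearEquiv.refl R _⟩
  | succ k ih =>
    intro q q' p p' hq hp hH
    obtain ⟨e⟩ := ih (q + 1) q' (p + 1) p' (by lia) (by lia) fun j h₁ h₂ => hH j (by lia) h₂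
    obtain ⟨e'⟩ := ext_equiv_stable (Y := Y) (u q) (π q) (huπ q) (hπ q) (hP q)
      (hH q le_rfl (by lia)) p
    exact ⟨e.trans ((stableSucc Y (u (q + 1)) p).symm.trans e')⟩

variable [∀ q, Module.Finite R (C q)] {d : ℕ}
  (hd : ∀ (X : Type u) [AddCommGroup X] [Module R X] [Module.Finite R X], ∀ p, d < p →
    Subsingleton (ExtModule R X Y p))

include hd

/-- Shifting `d` times carries a positive degree beyond `d`, where `Ext` into `Y` is zero. -/
lemma subsingleton_ext_of_ker_subsingleton (hH : ∀ j < d, Subsingleton (LinearMap.ker (u j)))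
    (p : ℕ) (hp : 1 ≤ p) : Subsingleton (ExtModule R (C 0) Y p) := by
  obtain ⟨p, rfl⟩ := Nat.exists_eq_add_of_le' hp
  obtain ⟨e⟩ := stable_equiv_stable_add u π huπ hπ hP d 0 d (p + 1) (p + d + 1) (by lia) (by lia)
    fun j _ h => hH j h
  have := hd (C d) (p + d + 1) (by lia)
  exact ((stableSucc Y (u d) (p + d)).trans
    (e.trans (stableSucc Y (u 0) p).symm)).symm.toEquiv.subsingleton

variable {n : ℕ} (hH : ∀ j < d + n, Subsingleton (LinearMap.ker (u j)))

lemma stable_equiv_ext_ker_top (q : ℕ) :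
    Nonempty (stable Y (u q) d ≃ₗ[R] ExtModule R (LinearMap.ker (u q)) Y d) :=
  stable_equiv_ext_ker (u q) (π q) (huπ q) (hπ q) (hP q) d (hd _ _ (by lia)) (hd _ _ (by lia))

include hH

/-- Degree `0` at position `n` shifts to degree `d` at position `d + n`. There the neighbouring
terms `Ext^{d+1}` and `Ext^{d+2}` of the cokernel vanish, so only the kernel contributes. -/
lemma ext_ker_equiv_stable_zero :
    Nonempty (ExtModule R (LinearMap.ker (u (d + n))) Y d ≃ₗ[R] stable Y (u n) 0) := by
  obtain ⟨e⟩ := stable_equiv_stable_add (Y := Y) u π huπ hπ hP d n (d + n) 0 d (by lia) (by lia)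
    fun j _ h => hH j h
  obtain ⟨e'⟩ := stable_equiv_ext_ker_top u π huπ hπ hP hd (d + n)
  exact ⟨e'.symm.trans e⟩

lemma subsingleton_stable_zero (i : ℕ) (hi : i < n) : Subsingleton (stable Y (u i) 0) := by
  obtain ⟨k, hk⟩ := Nat.exists_eq_add_of_lt hi
  obtain ⟨e⟩ := stable_equiv_stable_add (Y := Y) u π huπ hπ hP (d + k + 1) i (d + n) 0 (d + k + 1)
    (by lia) (by lia) fun j _ h => hH j h
  have := hd (C (d + n)) (d + k + 1) (by lia)
  exact ((stableSucc Y (u (d + n)) (d + k)).trans e).symm.toEquiv.subsingleton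

/-- This is the long exact sequence of `u (d + n)` around degrees `d - 2` and `d - 1`. Its `stable`
terms are shifted back to degree `0`; the term `Ext^d` of the cokernel is identified with `Ext^d` of
the next kernel; the sequence ends because `Ext^{d+1} = 0`. -/
theorem exists_exact_ascending :
    ∃ (f₁ : stable Y (u (n + 2)) 0 →ₗ[R]
          extInt R (LinearMap.ker (u (d + n))) Y ((d : ℤ) - 2))
      (f₂ : extInt R (LinearMap.ker (u (d + n))) Y ((d : ℤ) - 2) →ₗ[R]
          ExtModule R (LinearMap.ker (u (d + n + 1))) Y d)
      (f₃ : ExtModule R (LinearMap.ker (u (d + n + 1))) Y d →ₗ[R] stable Y (u (n + 1)) 0)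
      (f₄ : stable Y (u (n + 1)) 0 →ₗ[R]
          extInt R (LinearMap.ker (u (d + n))) Y ((d : ℤ) - 1)),
      Function.Exact f₁ f₂ ∧ Function.Exact f₂ f₃ ∧ Function.Exact f₃ f₄ ∧
        Function.Surjective f₄ := by
  obtain ⟨e₃⟩ := stable_equiv_ext_ker_top u π huπ hπ hP hd (d + n + 1)
  obtain ⟨a, b, c, ha, h⟩ :=
    exists_longExact (Y := Y) (u (d + n)) (π (d + n)) (huπ _) (hπ _) (hP _)
  -- For `d = 0` and `d = 1` the terms in negative degree are zero and the sequence shortens: for `d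
  -- = 0` the third map is an isomorphism, and for `d = 1` it is the injective start `a 0` of the
  -- long exact sequence.
  match d, hd, hH with
  | 0, hd, hH =>
    have : Subsingleton (extInt R (LinearMap.ker (u (0 + n))) Y (((0 : ℕ) : ℤ) - 2)) :=
      extInt_subsingleton_of_neg (by simp)
    have : Subsingleton (extInt R (LinearMap.ker (u (0 + n))) Y (((0 : ℕ) : ℤ) - 1)) :=
      extInt_subsingleton_of_neg (by simp)
    obtain ⟨e⟩ : Nonempty (stable Y (u (0 + n + 1)) 0 ≃ₗ[R] stable Y (u (n + 1)) 0) := by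
      rw [zero_add]; exact ⟨LinearEquiv.refl R _⟩
    let f := e₃.symm.trans e
    refine ⟨0, 0, f.toLinearMap, 0, fun x => ⟨fun _ => ⟨0, Subsingleton.elim _ _⟩, fun _ => rfl⟩,
      fun x => ?_, fun x => ⟨fun _ => f.surjective x, fun _ => rfl⟩,
      fun x => ⟨0, Subsingleton.elim _ _⟩⟩
    constructor
    · intro hx
      exact ⟨0, by rw [LinearMap.zero_apply]; exact (f.map_eq_zero_iff.mp hx).symm⟩
    · rintro ⟨y, rfl⟩
      exact map_zero _
  | 1, hd, hH =>
    have : Subsingleton (extInt R (LinearMap.ker (u (1 + n))) Y (((1 : ℕ) : ℤ) - 2)) :=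
      extInt_subsingleton_of_neg (by simp)
    obtain ⟨e₅⟩ : Nonempty (ExtModule R (LinearMap.ker (u (1 + n))) Y 0 ≃ₗ[R] _) :=
      extInt_equiv (z := ((1 : ℕ) : ℤ) - 1) (by simp)
    obtain ⟨e₄⟩ : Nonempty (stable Y (u (1 + n)) 0 ≃ₗ[R] stable Y (u (n + 1)) 0) := by
      rw [add_comm]; exact ⟨LinearEquiv.refl R _⟩
    let e₃' := (stableSucc Y (u (1 + n + 1)) 0).trans e₃
    have hb : Function.Surjective (b 0) := fun x => by
      have := hd (C (1 + n + 1)) 2 (by lia)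
      exact ((h 0).2.1 x).mp (Subsingleton.elim _ _)
    refine ⟨0, 0, e₄.toLinearMap ∘ₗ a 0 ∘ₗ e₃'.symm.toLinearMap,
      e₅.toLinearMap ∘ₗ b 0 ∘ₗ e₄.symm.toLinearMap,
      fun x => ⟨fun _ => ⟨0, Subsingleton.elim _ _⟩, fun _ => rfl⟩,
      fun x => ?_, (h 0).1.linearEquiv_conj e₃' e₄ e₅,
      e₅.surjective.comp (hb.comp e₄.symm.surjective)⟩
    have hinj : Function.Injective (e₄.toLinearMap ∘ₗ a 0 ∘ₗ e₃'.symm.toLinearMap) :=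
      e₄.injective.comp (ha.comp e₃'.symm.injective)
    constructor
    · intro hx
      exact ⟨0, by rw [LinearMap.zero_apply]; exact ((map_eq_zero_iff _ hinj).mp hx).symm⟩
    · rintro ⟨y, rfl⟩
      exact map_zero _
  | d + 2, hd, hH =>
    obtain ⟨e₂⟩ : Nonempty (ExtModule R (LinearMap.ker (u (d + 2 + n))) Y d ≃ₗ[R] _) :=
      extInt_equiv (z := ((d + 2 : ℕ) : ℤ) - 2) (by push_cast; ring)
    obtain ⟨e₅⟩ : Nonempty (ExtModule R (LinearMap.ker (u (d + 2 + n))) Y (d + 1) ≃ₗ[R] _) :=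
      extInt_equiv (z := ((d + 2 : ℕ) : ℤ) - 1) (by push_cast; ring)
    obtain ⟨e₁⟩ := stable_equiv_stable_add (Y := Y) u π huπ hπ hP d (n + 2) (d + 2 + n) 0 d
      (by lia) (by lia) fun j _ h => hH j h
    obtain ⟨e₄⟩ := stable_equiv_stable_add (Y := Y) u π huπ hπ hP (d + 1) (n + 1) (d + 2 + n) 0
      (d + 1) (by lia) (by lia) fun j _ h => hH j h
    let e₃' := (stableSucc Y (u (d + 2 + n + 1)) (d + 1)).trans e₃
    obtain ⟨f₁, f₂, f₃, f₄, h₁, h₂, h₃, -, h₄⟩ := exists_exact_of_linearEquiv e₁ e₂ e₃' e₄ e₅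
      (b d) (c d) (a (d + 1)) (b (d + 1)) (h d).2.1 (h d).2.2 (h (d + 1)).1
    refine ⟨f₁, f₂, f₃, f₄, h₁, h₂, h₃, h₄ fun x => ?_⟩
    have := hd (C (d + 2 + n + 1)) (d + 3) (by lia)
    exact ((h (d + 1)).2.1 x).mp (Subsingleton.elim _ _)

end Ascending

section Descending

variable {C P : ℕ → Type u} [∀ q, AddCommGroup (C q)] [∀ q, Module R (C q)]
  [∀ q, AddCommGroup (P q)] [∀ q, Module R (P q)]
  (u : ∀ q, C (q + 1) →ₗ[R] P q) (π : ∀ q, P q →ₗ[R] C q)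
  (huπ : ∀ q, Function.Exact (u q) (π q)) (hπ : ∀ q, Function.Surjective (π q))
  (hP : ∀ q p, 1 ≤ p → Subsingleton (ExtModule R (P q) Y p))

include huπ hπ hP

/-- Here `C i` is an `i`-th syzygy of `C 0` by acyclic modules. The bound `1 ≤ p` is needed because
in degree `0` the shift yields `stable`, not `Hom`. -/
lemma ext_equiv_ext_zero_add (i : ℕ) : ∀ p p' : ℕ, 1 ≤ p → p' = p + i →
    (∀ j < i, Subsingleton (LinearMap.ker (u j))) →
    Nonempty (ExtModule R (C i) Y p ≃ₗ[R] ExtModule R (C 0) Y p') := by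
  induction i with
  | zero =>
    rintro p p' - rfl -
    exact ⟨LinearEquiv.refl R _⟩
  | succ i ih =>
    intro p p' hp hp' hT
    obtain ⟨p, rfl⟩ := Nat.exists_eq_add_of_le' hp
    obtain ⟨e⟩ := ext_equiv_stable (Y := Y) (u i) (π i) (huπ i) (hπ i) (hP i)
      (hT i (by lia)) (p + 1)
    obtain ⟨e'⟩ := ih (p + 1 + 1) p' (by lia) (by lia) fun j hj => hT j (by lia)
    exact ⟨(stableSucc Y (u i) p).trans (e.symm.trans e')⟩

lemma ext_zero_equiv_stable_zero (i : ℕ) (hT : ∀ j ≤ i, Subsingleton (LinearMap.ker (u j))) :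
    Nonempty (ExtModule R (C 0) Y (i + 1) ≃ₗ[R] stable Y (u i) 0) := by
  obtain ⟨e⟩ := ext_equiv_stable (Y := Y) (u i) (π i) (huπ i) (hπ i) (hP i) (hT i le_rfl) 0
  obtain ⟨e'⟩ := ext_equiv_ext_zero_add (Y := Y) u π huπ hπ hP i 1 (i + 1) le_rfl (by lia)
    fun j hj => hT j hj.le
  exact ⟨e'.symm.trans e⟩

variable [Module.Finite R (C 0)] {d : ℕ}
  (hd : ∀ (X : Type u) [AddCommGroup X] [Module R X] [Module.Finite R X], ∀ p, d < p →
    Subsingleton (ExtModule R X Y p))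
  {n : ℕ} (hT : ∀ j < d + n, Subsingleton (LinearMap.ker (u j)))

include hd hT

lemma subsingleton_stable_zero_of_le (k : ℕ) (hdk : d ≤ k) (hk : k < d + n) :
    Subsingleton (stable Y (u k) 0) := by
  obtain ⟨e⟩ := ext_zero_equiv_stable_zero (Y := Y) u π huπ hπ hP k fun j hj => hT j (by lia)
  have := hd (C 0) (k + 1) (by lia)
  exact e.symm.toEquiv.subsingleton

lemma subsingleton_ext_of_one_le (p : ℕ) (hp : 1 ≤ p) :
    Subsingleton (ExtModule R (C (d + n)) Y p) := by
  obtain ⟨e⟩ := ext_equiv_ext_zero_add (Y := Y) u π huπ hπ hP (d + n) p (p + (d + n)) hp rfl hT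
  have := hd (C 0) (p + (d + n)) (by lia)
  exact e.toEquiv.subsingleton

lemma stable_equiv_ext_ker_of_subsingleton (p : ℕ) :
    Nonempty (stable Y (u (d + n)) p ≃ₗ[R] ExtModule R (LinearMap.ker (u (d + n))) Y p) :=
  stable_equiv_ext_ker _ _ (huπ _) (hπ _) (hP _) p
    (subsingleton_ext_of_one_le u π huπ hπ hP hd hT _ (by lia))
    (subsingleton_ext_of_one_le u π huπ hπ hP hd hT _ (by lia))

/-- Above position `d + n` the module `C (d + n)` has no higher `Ext`, so `C (d + n + 1)` and the
kernel of `u (d + n)` have the same positive `Ext`. The sequence is the start of the long exact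
sequence of `u (d + n + 1)`. -/
theorem exists_exact_descending :
    ∃ (g₁ : ExtModule R (LinearMap.ker (u (d + n))) Y 1 →ₗ[R] stable Y (u (d + n + 1)) 0)
      (g₂ : stable Y (u (d + n + 1)) 0 →ₗ[R] (LinearMap.ker (u (d + n + 1)) →ₗ[R] Y))
      (g₃ : (LinearMap.ker (u (d + n + 1)) →ₗ[R] Y) →ₗ[R]
          ExtModule R (LinearMap.ker (u (d + n))) Y 2)
      (g₄ : ExtModule R (LinearMap.ker (u (d + n))) Y 2 →ₗ[R] stable Y (u (d + n + 2)) 0),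
      Function.Exact g₁ g₂ ∧ Function.Exact g₂ g₃ ∧ Function.Exact g₃ g₄ ∧
        Function.Injective g₁ := by
  obtain ⟨a, b, c, ha, h⟩ := exists_longExact (Y := Y) (u (d + n + 1)) (π (d + n + 1))
    (huπ _) (hπ _) (hP _)
  obtain ⟨a', -, -, ha', -⟩ := exists_longExact (Y := Y) (u (d + n + 2)) (π (d + n + 2))
    (huπ _) (hπ _) (hP _)
  obtain ⟨e₁⟩ := stable_equiv_ext_ker_of_subsingleton u π huπ hπ hP hd hT 1
  obtain ⟨e₄⟩ := stable_equiv_ext_ker_of_subsingleton u π huπ hπ hP hd hT 2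
  let s := (stableSucc Y (u (d + n + 1)) 0).symm
  obtain ⟨g₁, g₂, g₃, g₄, h₁, h₂, h₃, h₄, -⟩ := exists_exact_of_linearEquiv
    ((stableSucc Y (u (d + n)) 0).trans e₁) (LinearEquiv.refl R (stable Y (u (d + n + 1)) 0))
    (zeroEquiv (LinearMap.ker (u (d + n + 1))) Y) ((stableSucc Y (u (d + n)) 1).trans e₄)
    -- The fifth term of the long exact sequence is `Ext^1` of `C (d + n + 2)`; it embeds by `a' 0`
    -- into the wanted term, and composing with an injection keeps exactness.
    (LinearEquiv.refl R (stable Y (u (d + n + 2)) 0))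
    (a 0) (b 0) (c 0) (a' 0 ∘ₗ s.toLinearMap ∘ₗ a 1) (h 0).1 (h 0).2.1
    ((h 0).2.2.comp_injective (a' 0 ∘ₗ s.toLinearMap) (ha'.comp s.injective) (map_zero _))
  exact ⟨g₁, g₂, g₃, g₄, h₁, h₂, h₃, h₄ ha⟩

end Descending

end ExtModule
end

/-! ### Homology as a kernel, finite free resolutions, and the computation of `Ext` and `Tor`. -/

noncomputable section

section CokMap

variable {R : Type*} [CommRing R] {K₂ K₁ K₀ Q A B : Type*} [AddCommGroup K₂] [Module R K₂]
  [AddCommGroup K₁] [Module R K₁] [AddCommGroup K₀] [Module R K₀] [AddCommGroup Q] [Module R Q]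
  [AddCommGroup A] [Module R A] [AddCommGroup B] [Module R B]

lemma LinearMap.nonempty_linearEquiv_of_surjective (s : Q →ₗ[R] A) (t : Q →ₗ[R] B)
    (hs : Function.Surjective s) (ht : Function.Surjective t) (h : ∀ x, s x = 0 ↔ t x = 0) :
    Nonempty (A ≃ₗ[R] B) :=
  ⟨(s.quotKerEquivOfSurjective hs).symm.trans ((Submodule.quotEquivOfEq _ _
    (by ext x; exact h x)).trans (t.quotKerEquivOfSurjective ht))⟩

/-- The map `K₁ / im α → K₀` induced by `β` in a complex `K₂ → K₁ → K₀`. Its kernel is the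
homology of the complex. -/
def cokMap (α : K₂ →ₗ[R] K₁) (β : K₁ →ₗ[R] K₀) (h : β ∘ₗ α = 0) :
    (K₁ ⧸ LinearMap.range α) →ₗ[R] K₀ :=
  (LinearMap.range α).liftQ β (LinearMap.range_le_ker_iff.2 h)

lemma exact_cokMap_mkQ (α : K₂ →ₗ[R] K₁) (β : K₁ →ₗ[R] K₀) (h : β ∘ₗ α = 0) :
    Function.Exact (cokMap α β h) (LinearMap.range β).mkQ := by
  intro x
  rw [Submodule.mkQ_apply, Submodule.Quotient.mk_eq_zero]
  constructor
  · rintro ⟨y, rfl⟩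
    exact ⟨Submodule.Quotient.mk y, rfl⟩
  · rintro ⟨y, rfl⟩
    obtain ⟨y, rfl⟩ := Submodule.Quotient.mk_surjective _ y
    exact ⟨y, rfl⟩

lemma subsingleton_ker_cokMap (α : K₂ →ₗ[R] K₁) (β : K₁ →ₗ[R] K₀) (h : Function.Exact α β) :
    Subsingleton (LinearMap.ker (cokMap α β h.linearMap_comp_eq_zero)) := by
  refine subsingleton_of_forall_eq 0 ?_
  rintro ⟨x, hx⟩
  obtain ⟨x, rfl⟩ := Submodule.Quotient.mk_surjective _ x
  rw [Subtype.ext_iff]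
  exact (Submodule.Quotient.mk_eq_zero _).mpr ((h x).mp hx)

/-- A recognition principle for the homology of a complex of modules. -/
lemma nonempty_ker_cokMap_equiv (α : K₂ →ₗ[R] K₁) (β : K₁ →ₗ[R] K₀) (h : β ∘ₗ α = 0)
    (s : Q →ₗ[R] K₁) (t : Q →ₗ[R] A) (ht : Function.Surjective t)
    (hs : Function.Exact s β) (hst : ∀ x, t x = 0 ↔ s x ∈ LinearMap.range α) :
    Nonempty (LinearMap.ker (cokMap α β h) ≃ₗ[R] A) := by
  refine LinearMap.nonempty_linearEquiv_of_surjective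
    (((LinearMap.range α).mkQ ∘ₗ s).codRestrict (LinearMap.ker (cokMap α β h)) fun x => ?_) t ?_ ht
    fun x => ?_
  · exact (hs _).mpr ⟨x, rfl⟩
  · rintro ⟨y, hy⟩
    obtain ⟨y, rfl⟩ := Submodule.Quotient.mk_surjective _ y
    obtain ⟨x, rfl⟩ := (hs y).mp hy
    exact ⟨x, rfl⟩
  · rw [hst, Subtype.ext_iff]
    exact Submodule.Quotient.mk_eq_zero _

lemma nonempty_ker_cokMap_congr {L₂ L₁ L₀ : Type*} [AddCommGroup L₂] [Module R L₂]
    [AddCommGroup L₁] [Module R L₁] [AddCommGroup L₀] [Module R L₀]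
    (α : K₂ →ₗ[R] K₁) (β : K₁ →ₗ[R] K₀) (h : β ∘ₗ α = 0)
    (α' : L₂ →ₗ[R] L₁) (β' : L₁ →ₗ[R] L₀) (h' : β' ∘ₗ α' = 0)
    (e₂ : K₂ ≃ₗ[R] L₂) (e₁ : K₁ ≃ₗ[R] L₁) (e₀ : K₀ ≃ₗ[R] L₀)
    (hα : ∀ x, e₁ (α x) = α' (e₂ x)) (hβ : ∀ x, e₀ (β x) = β' (e₁ x)) :
    Nonempty (LinearMap.ker (cokMap α β h) ≃ₗ[R] LinearMap.ker (cokMap α' β' h')) := by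
  refine nonempty_ker_cokMap_equiv α β h (LinearMap.ker β).subtype
    (((LinearMap.range α').mkQ ∘ₗ e₁.toLinearMap ∘ₗ (LinearMap.ker β).subtype).codRestrict
      (LinearMap.ker (cokMap α' β' h')) ?_) ?_ ?_ ?_
  · rintro ⟨x, hx⟩
    change β' (e₁ x) = 0
    rw [← hβ, LinearMap.mem_ker.mp hx, map_zero]
  · rintro ⟨y, hy⟩
    obtain ⟨y, rfl⟩ := Submodule.Quotient.mk_surjective _ y
    obtain ⟨x, rfl⟩ := e₁.surjective y
    have hx : β' (e₁ x) = 0 := hy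
    rw [← hβ, LinearEquiv.map_eq_zero_iff] at hx
    exact ⟨⟨x, hx⟩, rfl⟩
  · intro x; simp
  · rintro ⟨x, hx⟩
    rw [Subtype.ext_iff]
    refine (Submodule.Quotient.mk_eq_zero _).trans ?_
    constructor
    · rintro ⟨y, hy⟩
      obtain ⟨y, rfl⟩ := e₂.surjective y
      rw [← hα] at hy
      exact ⟨y, e₁.injective hy⟩
    · rintro ⟨y, hy⟩
      exact ⟨e₂ y, by rw [← hα, hy]; rfl⟩

end CokMap

lemma LinearMap.lcomp_comp_lcomp_eq_zero {R K₂ K₁ K₀ : Type*} [CommRing R] [AddCommGroup K₂]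
    [Module R K₂] [AddCommGroup K₁] [Module R K₁] [AddCommGroup K₀] [Module R K₀]
    {α : K₂ →ₗ[R] K₁} {β : K₁ →ₗ[R] K₀} (h : β ∘ₗ α = 0) (Y : Type*) [AddCommGroup Y]
    [Module R Y] : LinearMap.lcomp R Y α ∘ₗ LinearMap.lcomp R Y β = 0 := by
  ext φ x
  simpa using congrArg φ (LinearMap.congr_fun h x)

namespace ExtModule

variable {R : Type u} [CommRing R] {Y : Type u} [AddCommGroup Y] [Module R Y]

/-- The degree zero part of `stable` is a homology module of the dual complex. -/
lemma nonempty_stable_zero_equiv {K₂ K₁ K₀ : Type u} [AddCommGroup K₂] [Module R K₂]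
    [AddCommGroup K₁] [Module R K₁] [AddCommGroup K₀] [Module R K₀]
    (α : K₂ →ₗ[R] K₁) (β : K₁ →ₗ[R] K₀) (h : β ∘ₗ α = 0) :
    Nonempty (LinearMap.ker (cokMap (LinearMap.lcomp R Y β) (LinearMap.lcomp R Y α)
      (LinearMap.lcomp_comp_lcomp_eq_zero h Y)) ≃ₗ[R] stable Y (cokMap α β h) 0) := by
  refine nonempty_ker_cokMap_equiv _ _ _ (LinearMap.lcomp R Y (LinearMap.range α).mkQ)
    (stableMk Y (cokMap α β h)) (stableMk_surjective _) ?_ ?_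
  · intro φ
    constructor
    · intro hφ
      exact ⟨(LinearMap.range α).liftQ φ (LinearMap.range_le_ker_iff.2 hφ),
        Submodule.liftQ_mkQ (LinearMap.range α) φ (LinearMap.range_le_ker_iff.2 hφ)⟩
    · rintro ⟨ψ, rfl⟩
      ext x
      have : (Submodule.Quotient.mk (α x) : K₁ ⧸ LinearMap.range α) = 0 :=
        (Submodule.Quotient.mk_eq_zero _).mpr ⟨x, rfl⟩
      simp [this]
  · intro φ
    rw [stableMk_eq_zero_iff]
    constructor
    · rintro ⟨ψ, rfl⟩
      exact ⟨ψ, rfl⟩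
    · rintro ⟨ψ, hψ⟩
      refine ⟨ψ, ?_⟩
      ext x
      exact LinearMap.congr_fun hψ x

end ExtModule

lemma ChainComplex.nonempty_homology_equiv {R : Type u} [CommRing R]
    (K : ChainComplex (ModuleCat.{u} R) ℕ) (i : ℕ) :
    Nonempty (K.homology (i + 1) ≃ₗ[R] LinearMap.ker (cokMap (K.d (i + 1 + 1) (i + 1)).hom
      (K.d (i + 1) i).hom (by rw [← ModuleCat.hom_comp, K.d_comp_d]; rfl))) := by
  let S := K.sc' (i + 1 + 1) (i + 1) i
  let e₁ : K.homology (i + 1) ≃ₗ[R] S.homology :=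
    (ShortComplex.homologyMapIso (K.isoSc' (i + 1 + 1) (i + 1) i (by simp) (by simp))).toLinearEquiv
  let e₂ : S.homology ≃ₗ[R] (LinearMap.ker S.g.hom ⧸ LinearMap.range S.moduleCatToCycles) :=
    S.moduleCatHomologyIso.toLinearEquiv
  obtain ⟨e₃⟩ := nonempty_ker_cokMap_equiv S.f.hom S.g.hom
    (by rw [← ModuleCat.hom_comp, S.zero]; rfl) (LinearMap.ker S.g.hom).subtype
    (LinearMap.range S.moduleCatToCycles).mkQ (Submodule.mkQ_surjective _) (fun x => by simp)
    (fun x => by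
      rw [Submodule.mkQ_apply, Submodule.Quotient.mk_eq_zero]
      simp only [LinearMap.mem_range, Subtype.ext_iff]
      rfl)
  exact ⟨e₁.trans (e₂.trans e₃.symm)⟩

/-- A resolution of `M` by finite free modules. -/
structure FiniteFreeResolution (R : Type u) [CommRing R] (M : Type u) [AddCommGroup M]
    [Module R M] where
  /-- the ranks of the free modules -/
  rank : ℕ → ℕ
  /-- the differentials -/
  d : ∀ i, (Fin (rank (i + 1)) → R) →ₗ[R] (Fin (rank i) → R)
  /-- the augmentation -/
  ε : (Fin (rank 0) → R) →ₗ[R] M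
  ε_surjective : Function.Surjective ε
  exact_zero : Function.Exact (d 0) ε
  exact_succ : ∀ i, Function.Exact (d (i + 1)) (d i)

namespace FiniteFreeResolution

variable {R : Type u} [CommRing R]

lemma exists_exact [IsNoetherianRing R] {m : ℕ} {M : Type u} [AddCommGroup M] [Module R M]
    (f : (Fin m → R) →ₗ[R] M) :
    ∃ (k : ℕ) (g : (Fin k → R) →ₗ[R] (Fin m → R)), Function.Exact g f := by
  obtain ⟨k, g, hg⟩ := Module.Finite.exists_fin' R (LinearMap.ker f)
  refine ⟨k, (LinearMap.ker f).subtype ∘ₗ g, fun x => ⟨fun hx => ?_, ?_⟩⟩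
  · obtain ⟨y, hy⟩ := hg ⟨x, hx⟩
    exact ⟨y, by simp [hy]⟩
  · rintro ⟨y, rfl⟩
    exact (g y).2

theorem nonempty [IsNoetherianRing R] (M : Type u) [AddCommGroup M] [Module R M]
    [Module.Finite R M] : Nonempty (FiniteFreeResolution R M) := by
  obtain ⟨m, ε, hε⟩ := Module.Finite.exists_fin' R M
  obtain ⟨m₁, d₀, hd₀⟩ := exists_exact ε
  -- The recursion carries a differential together with its ranks, and sends it to a map covering
  -- its kernel.
  choose k g hg using fun (x : Σ (m k : ℕ), (Fin k → R) →ₗ[R] (Fin m → R)) =>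
    exists_exact x.2.2
  let seq : ℕ → Σ (m k : ℕ), (Fin k → R) →ₗ[R] (Fin m → R) := fun i =>
    Nat.rec ⟨m, m₁, d₀⟩ (fun _ x => ⟨x.2.1, k x, g x⟩) i
  exact ⟨{ rank := fun i => (seq i).1, d := fun i => (seq i).2.2, ε := ε, ε_surjective := hε
           exact_zero := hd₀, exact_succ := fun i => hg (seq i) }⟩

variable {M : Type u} [AddCommGroup M] [Module R M] (F : FiniteFreeResolution R M)

lemma d_comp_d (i : ℕ) : F.d i ∘ₗ F.d (i + 1) = 0 := (F.exact_succ i).linearMap_comp_eq_zero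

lemma rTensor_d_comp_d (N : Type u) [AddCommGroup N] [Module R N] (i : ℕ) :
    LinearMap.rTensor N (F.d i) ∘ₗ LinearMap.rTensor N (F.d (i + 1)) = 0 := by
  rw [← LinearMap.rTensor_comp, F.d_comp_d, LinearMap.rTensor_zero]

/-- `Ext^{i+1}(M, N)` is the cohomology of `Hom(F, N)`. -/
theorem nonempty_ext_equiv (N : Type u) [AddCommGroup N] [Module R N] (i : ℕ) :
    Nonempty (ExtModule R M N (i + 1) ≃ₗ[R]
      LinearMap.ker (cokMap (LinearMap.lcomp R N (F.d i)) (LinearMap.lcomp R N (F.d (i + 1)))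
        (LinearMap.lcomp_comp_lcomp_eq_zero (F.d_comp_d i) N))) := by
  -- The descending chain is applied to the resolution itself, where all kernels vanish by
  -- exactness.
  obtain ⟨e⟩ := ExtModule.ext_zero_equiv_stable_zero (R := R) (Y := N)
    (C := fun i => (Fin (F.rank i) → R) ⧸ LinearMap.range (F.d i))
    (P := fun i => Fin (F.rank i) → R)
    (fun i => cokMap (F.d (i + 1)) (F.d i) (F.d_comp_d i))
    (fun i => (LinearMap.range (F.d i)).mkQ)
    (fun i => exact_cokMap_mkQ _ _ _) (fun i => Submodule.mkQ_surjective _)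
    (fun i p hp => ExtModule.subsingleton_of_projective p hp) i
    (fun j _ => subsingleton_ker_cokMap _ _ (F.exact_succ j))
  obtain ⟨e'⟩ := ExtModule.nonempty_stable_zero_equiv (Y := N) (F.d (i + 1)) (F.d i)
    (F.d_comp_d i)
  obtain ⟨e₀⟩ := LinearMap.nonempty_linearEquiv_of_surjective F.ε (LinearMap.range (F.d 0)).mkQ
    F.ε_surjective (Submodule.mkQ_surjective _) fun x => by
      rw [F.exact_zero x, Submodule.mkQ_apply, Submodule.Quotient.mk_eq_zero]; rfl
  exact ⟨(ExtModule.congrLeft e₀ (i + 1)).trans (e.trans e'.symm)⟩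

/-- The complex of a finite free resolution. -/
def complex : ChainComplex (ModuleCat.{u} R) ℕ :=
  ChainComplex.of (fun i => ModuleCat.of R (Fin (F.rank i) → R)) (fun i => ModuleCat.ofHom (F.d i))
    fun i => by rw [← ModuleCat.ofHom_comp, F.d_comp_d]; rfl

lemma complex_d (i : ℕ) : F.complex.d (i + 1) i = ModuleCat.ofHom (F.d i) := by
  simp [complex]

lemma complex_d_comp_ε : (F.complex.d 1 0 ≫ ModuleCat.ofHom F.ε :
    F.complex.X 1 ⟶ ModuleCat.of R M) = 0 := by
  rw [complex_d]
  exact (ModuleCat.ofHom_comp _ _).symm.trans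
    (by rw [F.exact_zero.linearMap_comp_eq_zero]; rfl)

/-- A finite free resolution as a projective resolution in the category of modules. -/
def toProjectiveResolution : ProjectiveResolution (ModuleCat.of R M) where
  complex := F.complex
  projective n := inferInstanceAs (Projective (ModuleCat.of R (Fin (F.rank n) → R)))
  π := (ChainComplex.toSingle₀Equiv _ _).symm ⟨ModuleCat.ofHom F.ε, F.complex_d_comp_ε⟩
  quasiIso := ⟨fun n => by
    cases n
    · rw [ChainComplex.quasiIsoAt₀_iff, ShortComplex.quasiIso_iff_of_zeros']
      · refine (ShortComplex.exact_and_epi_g_iff_of_iso ?_).2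
          ⟨ModuleCat.shortComplex_exact (ModuleCat.shortComplexOfCompEqZero (F.d 0) F.ε
            F.exact_zero.linearMap_comp_eq_zero) F.exact_zero,
            (ModuleCat.epi_iff_surjective _).mpr F.ε_surjective⟩
        exact ShortComplex.isoMk (Iso.refl _) (Iso.refl _) (Iso.refl _)
          ((Category.id_comp _).trans ((F.complex_d 0).symm.trans (Category.comp_id _).symm))
          ((Category.id_comp _).trans (Eq.trans (ChainComplex.toSingle₀Equiv_symm_apply_f_zero
            (C := F.complex) (X := ModuleCat.of R M) (ModuleCat.ofHom F.ε)
            F.complex_d_comp_ε).symm (Category.comp_id _).symm))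
      all_goals rfl
    · rename_i n
      rw [quasiIsoAt_iff_exactAt']
      · rw [HomologicalComplex.exactAt_iff' _ (n + 1 + 1) (n + 1) n (by simp) (by simp)]
        have h : Function.Exact (F.complex.d (n + 1 + 1) (n + 1)).hom
            (F.complex.d (n + 1) n).hom := by
          rw [complex_d, complex_d]
          exact F.exact_succ n
        exact ModuleCat.shortComplex_exact _ h
      · apply ChainComplex.exactAt_succ_single_obj⟩

/-- `Tor_{i+1}(M, N)` is the homology of `F ⊗ N`. -/
theorem nonempty_tor_equiv (N : Type u) [AddCommGroup N] [Module R N] (i : ℕ) :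
    Nonempty (TorModule R M N (i + 1) ≃ₗ[R]
      LinearMap.ker (cokMap (LinearMap.rTensor N (F.d (i + 1))) (LinearMap.rTensor N (F.d i))
        (F.rTensor_d_comp_d N i))) := by
  let T := (MonoidalCategory.tensoringRight (ModuleCat.{u} R)).obj (ModuleCat.of R N)
  let K := (T.mapHomologicalComplex (ComplexShape.down ℕ)).obj F.complex
  have hd : ∀ i, (K.d (i + 1) i).hom = LinearMap.rTensor N (F.d i) := fun i => by
    change (T.map (F.complex.d (i + 1) i)).hom = _
    rw [complex_d]
    rfl
  obtain ⟨e⟩ := ChainComplex.nonempty_homology_equiv K i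
  let e₁ : TorModule R M N (i + 1) ≃ₗ[R] K.homology (i + 1) :=
    (F.toProjectiveResolution.isoLeftDerivedObj T (i + 1)).toLinearEquiv
  refine ⟨e₁.trans (e.trans (Nonempty.some (nonempty_ker_cokMap_congr _ _ _ _ _ _
    (LinearEquiv.refl R _) (LinearEquiv.refl R _) (LinearEquiv.refl R _) ?_ ?_)))⟩
  · intro x
    exact LinearMap.congr_fun (hd (i + 1)) x
  · intro x
    exact LinearMap.congr_fun (hd i) x

end FiniteFreeResolution
end

/-! ### Duality between `Hom(F, N)` and `F ⊗ N†`. -/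

noncomputable section

section Duality

variable {R : Type*} [CommRing R] {N ω : Type*} [AddCommGroup N] [Module R N]
  [AddCommGroup ω] [Module R ω]

/-- The natural map `F ⊗ Hom(N, ω) → Hom(Hom(F, N), ω)`. -/
def tensorDualMap (R N ω F : Type*) [CommRing R] [AddCommGroup N] [Module R N]
    [AddCommGroup ω] [Module R ω] [AddCommGroup F] [Module R F] :
    F ⊗[R] (N →ₗ[R] ω) →ₗ[R] ((F →ₗ[R] N) →ₗ[R] ω) :=
  TensorProduct.lift ((LinearMap.llcomp R (F →ₗ[R] N) N ω).flip ∘ₗ LinearMap.applyₗ)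

@[simp]
lemma tensorDualMap_tmul {F : Type*} [AddCommGroup F] [Module R F] (x : F) (φ : N →ₗ[R] ω)
    (g : F →ₗ[R] N) : tensorDualMap R N ω F (x ⊗ₜ φ) g = φ (g x) := rfl

lemma tensorDualMap_rTensor {F F' : Type*} [AddCommGroup F] [Module R F] [AddCommGroup F']
    [Module R F'] (f : F →ₗ[R] F') (x : F ⊗[R] (N →ₗ[R] ω)) :
    tensorDualMap R N ω F' (LinearMap.rTensor _ f x) =
      LinearMap.lcomp R ω (LinearMap.lcomp R N f) (tensorDualMap R N ω F x) := by
  induction x with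
  | zero => simp
  | tmul x φ => ext g; simp
  | add x y hx hy => rw [map_add, map_add, map_add, map_add, hx, hy]

/-- For a finite free module `F`, the natural map `F ⊗ Hom(N, ω) → Hom(Hom(F, N), ω)` is an
isomorphism. -/
def tensorDualEquiv (R N ω : Type*) [CommRing R] [AddCommGroup N] [Module R N]
    [AddCommGroup ω] [Module R ω] (m : ℕ) :
    (Fin m → R) ⊗[R] (N →ₗ[R] ω) ≃ₗ[R] (((Fin m → R) →ₗ[R] N) →ₗ[R] ω) :=
  LinearEquiv.ofLinearMap (tensorDualMap R N ω _)
    -- The inverse sends `Ψ` to the sum of `e_i ⊗ Ψ_i`, where `Ψ_i x` is the value of `Ψ` at the map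
    -- `y ↦ y_i • x`.
    (∑ i : Fin m, TensorProduct.mk R _ _ (Pi.single i 1) ∘ₗ
      LinearMap.lcomp R ω (LinearMap.smulRightₗ (LinearMap.proj i)))
    (by
      ext Ψ g
      simp only [LinearMap.comp_apply, LinearMap.sum_apply, map_sum, TensorProduct.mk_apply,
        tensorDualMap_tmul, LinearMap.lcomp_apply, LinearMap.id_apply]
      rw [← map_sum]
      congr 1
      ext i
      simp [Pi.single_apply])
    (by
      ext i φ
      simp only [LinearMap.comp_apply, LinearMap.sum_apply, TensorProduct.mk_apply,
        LinearMap.id_apply, TensorProduct.AlgebraTensorModule.curry_apply,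
        TensorProduct.curry_apply, LinearMap.coe_restrictScalars, LinearMap.coe_single,
        LinearMap.lcomp_apply']
      rw [Finset.sum_eq_single i]
      · congr 1
        ext x
        simp
      · intro j _ hj
        have : tensorDualMap R N ω (Fin m → R) (Pi.single i 1 ⊗ₜ[R] φ) ∘ₗ
            LinearMap.smulRightₗ (LinearMap.proj j) = 0 := by
          ext x
          simp [hj]
        rw [this, TensorProduct.tmul_zero]
      · simp)

end Duality

namespace ExtModule

variable {R : Type u} [CommRing R] {N Y : Type u} [AddCommGroup N] [Module R N]
  [AddCommGroup Y] [Module R Y]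

lemma subsingleton_pi (m p : ℕ) (h : Subsingleton (ExtModule R N Y p)) :
    Subsingleton (ExtModule R (Fin m → N) Y p) := by
  induction m with
  | zero => exact subsingleton_of_subsingleton p
  | succ m ih =>
    have : Subsingleton (ExtModule R (N × (Fin m → N)) Y p) :=
      subsingleton_middle (LinearMap.inl R N (Fin m → N)) (LinearMap.snd R N (Fin m → N))
        LinearMap.inl_injective (fun x => by
          constructor
          · intro hx
            exact ⟨x.1, Prod.ext rfl hx.symm⟩
          · rintro ⟨y, rfl⟩
            rfl) LinearMap.snd_surjective p h ih
    exact (congrLeft (Fin.consLinearEquiv R fun _ : Fin (m + 1) => N) p).symm.toEquiv.subsingleton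

lemma subsingleton_hom_fin (m p : ℕ) (h : Subsingleton (ExtModule R N Y p)) :
    Subsingleton (ExtModule R ((Fin m → R) →ₗ[R] N) Y p) :=
  have := subsingleton_pi m p h
  (congrLeft ((Pi.basisFun R (Fin m)).constr R) p).symm.toEquiv.subsingleton

lemma subsingleton_fin_tensor (m p : ℕ) (h : Subsingleton (ExtModule R N Y p)) :
    Subsingleton (ExtModule R ((Fin m → R) ⊗[R] N) Y p) :=
  have := subsingleton_pi m p h
  (congrLeft ((TensorProduct.comm R _ _).trans (TensorProduct.piScalarRight R R N (Fin m)))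
    p).toEquiv.subsingleton

end ExtModule

namespace FiniteFreeResolution

variable {R : Type u} [CommRing R] {M : Type u} [AddCommGroup M] [Module R M]
  (F : FiniteFreeResolution R M)

section Hom

variable (N : Type u) [AddCommGroup N] [Module R N]

/-- The map `G^{q+1} / im G^q → G^{q+2}` for the complex `G = Hom(F, N)`. -/
abbrev homCok (q : ℕ) :
    (((Fin (F.rank (q + 1)) → R) →ₗ[R] N) ⧸ LinearMap.range (LinearMap.lcomp R N (F.d q))) →ₗ[R]
      ((Fin (F.rank (q + 1 + 1)) → R) →ₗ[R] N) :=
  cokMap (LinearMap.lcomp R N (F.d q)) (LinearMap.lcomp R N (F.d (q + 1)))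
    (LinearMap.lcomp_comp_lcomp_eq_zero (F.d_comp_d q) N)

/-- The map `K_{q+1} / im K_{q+2} → K_q` for the complex `K = F ⊗ N`. -/
abbrev tensorCok (q : ℕ) :
    (((Fin (F.rank (q + 1)) → R) ⊗[R] N) ⧸ LinearMap.range (LinearMap.rTensor N (F.d (q + 1))))
      →ₗ[R] ((Fin (F.rank q) → R) ⊗[R] N) :=
  cokMap (LinearMap.rTensor N (F.d (q + 1))) (LinearMap.rTensor N (F.d q))
    (F.rTensor_d_comp_d N q)

/-- The left side is a homology module of `Hom(Hom(F, N), ω)`, and this complex is `F ⊗ N†` by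
naturality of `tensorDualEquiv`. -/
lemma nonempty_stable_homCok_equiv (ω : Type u) [AddCommGroup ω] [Module R ω] (q : ℕ) :
    Nonempty (ExtModule.stable ω (F.homCok N q) 0 ≃ₗ[R] TorModule R M (N →ₗ[R] ω) (q + 1)) := by
  obtain ⟨e₁⟩ := ExtModule.nonempty_stable_zero_equiv (Y := ω) (LinearMap.lcomp R N (F.d q))
    (LinearMap.lcomp R N (F.d (q + 1))) (LinearMap.lcomp_comp_lcomp_eq_zero (F.d_comp_d q) N)
  obtain ⟨e₂⟩ := F.nonempty_tor_equiv (N →ₗ[R] ω) q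
  obtain ⟨e₃⟩ := nonempty_ker_cokMap_congr (LinearMap.rTensor (N →ₗ[R] ω) (F.d (q + 1)))
    (LinearMap.rTensor (N →ₗ[R] ω) (F.d q)) (F.rTensor_d_comp_d _ q)
    (LinearMap.lcomp R ω (LinearMap.lcomp R N (F.d (q + 1))))
    (LinearMap.lcomp R ω (LinearMap.lcomp R N (F.d q)))
    (LinearMap.lcomp_comp_lcomp_eq_zero (LinearMap.lcomp_comp_lcomp_eq_zero (F.d_comp_d q) N) ω)
    (tensorDualEquiv R N ω _) (tensorDualEquiv R N ω _) (tensorDualEquiv R N ω _)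
    (fun x => tensorDualMap_rTensor _ x) (fun x => tensorDualMap_rTensor _ x)
  exact ⟨e₁.symm.trans (e₃.symm.trans e₂.symm)⟩

/-- By adjunction `Hom(F ⊗ N, ω)` is `Hom(F, N†)`. In the application `N` is itself a dual, and `N'`
is the module whose dual it is. -/
lemma nonempty_stable_tensorCok_equiv {ω N' : Type u} [AddCommGroup ω] [Module R ω]
    [AddCommGroup N'] [Module R N'] (e : (N →ₗ[R] ω) ≃ₗ[R] N') (q : ℕ) :
    Nonempty (ExtModule.stable ω (F.tensorCok N q) 0 ≃ₗ[R] ExtModule R M N' (q + 1)) := by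
  obtain ⟨e₁⟩ := ExtModule.nonempty_stable_zero_equiv (Y := ω)
    (LinearMap.rTensor N (F.d (q + 1))) (LinearMap.rTensor N (F.d q)) (F.rTensor_d_comp_d N q)
  obtain ⟨e₂⟩ := F.nonempty_ext_equiv N' q
  let E : ∀ m : ℕ, ((Fin m → R) ⊗[R] N →ₗ[R] ω) ≃ₗ[R] ((Fin m → R) →ₗ[R] N') := fun m =>
    (TensorProduct.lift.equiv (RingHom.id R) (Fin m → R) N ω).symm.trans (LinearEquiv.congrRight e)
  have hE : ∀ (m k : ℕ) (f : (Fin m → R) →ₗ[R] (Fin k → R)) (x),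
      E m (LinearMap.lcomp R ω (LinearMap.rTensor N f) x) = LinearMap.lcomp R N' f (E k x) := by
    intro m k f x
    refine LinearMap.ext fun y => congrArg e (LinearMap.ext fun z => ?_)
    simp
  obtain ⟨e₃⟩ := nonempty_ker_cokMap_congr
    (LinearMap.lcomp R ω (LinearMap.rTensor N (F.d q)))
    (LinearMap.lcomp R ω (LinearMap.rTensor N (F.d (q + 1))))
    (LinearMap.lcomp_comp_lcomp_eq_zero (F.rTensor_d_comp_d N q) ω)
    (LinearMap.lcomp R N' (F.d q)) (LinearMap.lcomp R N' (F.d (q + 1)))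
    (LinearMap.lcomp_comp_lcomp_eq_zero (F.d_comp_d q) N')
    (E _) (E _) (E _) (fun x => hE _ _ _ x) (fun x => hE _ _ _ x)
  exact ⟨e₁.symm.trans (e₃.trans e₂.symm)⟩

/-- Both sides are the cokernel of `F_1 ⊗ N† → F_0 ⊗ N†`, by right exactness of the tensor product.
-/
lemma nonempty_stable_lcomp_equiv (ω : Type u) [AddCommGroup ω] [Module R ω] :
    Nonempty (M ⊗[R] (N →ₗ[R] ω) ≃ₗ[R] ExtModule.stable ω (LinearMap.lcomp R N (F.d 0)) 0) := by
  refine LinearMap.nonempty_linearEquiv_of_surjective (LinearMap.rTensor _ F.ε)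
    (ExtModule.stableMk ω (LinearMap.lcomp R N (F.d 0)) ∘ₗ (tensorDualEquiv R N ω _).toLinearMap)
    (LinearMap.rTensor_surjective _ F.ε_surjective)
    ((ExtModule.stableMk_surjective _).comp (tensorDualEquiv R N ω _).surjective) fun x => ?_
  rw [rTensor_exact _ F.exact_zero F.ε_surjective x, LinearMap.comp_apply,
    ExtModule.stableMk_eq_zero_iff]
  constructor
  · rintro ⟨y, rfl⟩
    exact ⟨tensorDualEquiv R N ω _ y, (tensorDualMap_rTensor _ _).symm⟩
  · rintro ⟨ψ, hψ⟩
    obtain ⟨y, rfl⟩ := (tensorDualEquiv R N ω _).surjective ψ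
    exact ⟨y, (tensorDualEquiv R N ω _).injective ((tensorDualMap_rTensor _ _).trans hψ)⟩

lemma nonempty_hom_equiv :
    Nonempty ((M →ₗ[R] N) ≃ₗ[R] LinearMap.ker (LinearMap.lcomp R N (F.d 0))) := by
  have h : Function.Exact (LinearMap.lcomp R N F.ε) (LinearMap.lcomp R N (F.d 0)) :=
    LinearMap.exact_lcomp_of_exact_of_surjective N F.exact_zero F.ε_surjective
  refine ⟨(LinearEquiv.ofInjective (LinearMap.lcomp R N F.ε) ?_).trans
    (LinearEquiv.ofEq _ _ h.linearMap_ker_eq.symm)⟩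
  exact LinearMap.lcomp_injective_of_surjective _ F.ε_surjective

end Hom

end FiniteFreeResolution
end

/-! ### The homological content of (i), (ii) and (iii). -/

noncomputable section

namespace ExtModule

/-- Part (iii) for any complex `K` of modules without higher `Ext` into `ω`: `T q` is `H_{q+1}(K)`,
`E q` is `H^{q+1}(Hom(K, ω))` and `A` is `H_0(K)`. -/
theorem cohomology_of_subsingleton_homology {R : Type u} [CommRing R] {ω : Type u}
    [AddCommGroup ω] [Module R ω] {d n : ℕ} {K T E : ℕ → Type u} {A : Type u}
    [∀ q, AddCommGroup (K q)] [∀ q, Module R (K q)] [∀ q, AddCommGroup (T q)]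
    [∀ q, Module R (T q)] [∀ q, AddCommGroup (E q)] [∀ q, Module R (E q)]
    [AddCommGroup A] [Module R A] [Module.Finite R (K 0)]
    (D : ∀ q, K (q + 1) →ₗ[R] K q) (hD : ∀ q, D q ∘ₗ D (q + 1) = 0)
    (hP : ∀ q p, 1 ≤ p → Subsingleton (ExtModule R (K q) ω p))
    (eT : ∀ q, T q ≃ₗ[R] LinearMap.ker (cokMap (D (q + 1)) (D q) (hD q)))
    (eE : ∀ q, stable ω (cokMap (D (q + 1)) (D q) (hD q)) 0 ≃ₗ[R] E q)
    (e₀ : A ≃ₗ[R] (K 0 ⧸ LinearMap.range (D 0)))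
    (hd : ∀ (X : Type u) [AddCommGroup X] [Module R X] [Module.Finite R X], ∀ p, d < p →
      Subsingleton (ExtModule R X ω p))
    (hT : ∀ j < d + n, Subsingleton (T j)) :
    Nonempty ((T (d + n) →ₗ[R] ω) ≃ₗ[R] E (d + n)) ∧
    (∀ i < d, Nonempty (ExtModule R A ω (i + 1) ≃ₗ[R] E i)) ∧
    (∀ k, d ≤ k → k < d + n → Subsingleton (E k)) ∧
    ∃ (g₁ : ExtModule R (T (d + n)) ω 1 →ₗ[R] E (d + n + 1))
      (g₂ : E (d + n + 1) →ₗ[R] (T (d + n + 1) →ₗ[R] ω))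
      (g₃ : (T (d + n + 1) →ₗ[R] ω) →ₗ[R] ExtModule R (T (d + n)) ω 2)
      (g₄ : ExtModule R (T (d + n)) ω 2 →ₗ[R] E (d + n + 2)),
      Function.Injective g₁ ∧ Function.Exact g₁ g₂ ∧ Function.Exact g₂ g₃ ∧
        Function.Exact g₃ g₄ := by
  let C : ℕ → Type u := fun q => K q ⧸ LinearMap.range (D q)
  let u : ∀ q, C (q + 1) →ₗ[R] K q := fun q => cokMap (D (q + 1)) (D q) (hD q)
  let π : ∀ q, K q →ₗ[R] C q := fun q => (LinearMap.range (D q)).mkQ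
  have hex : ∀ q, Function.Exact (u q) (π q) := fun q => exact_cokMap_mkQ _ _ _
  have hsurj : ∀ q, Function.Surjective (π q) := fun q => Submodule.mkQ_surjective _
  have hT' : ∀ j < d + n, Subsingleton (LinearMap.ker (u j)) := fun j hj => by
    have := hT j hj
    exact (eT j).symm.toEquiv.subsingleton
  refine ⟨?_, fun i hi => ?_, fun k hk hkn => ?_, ?_⟩
  · obtain ⟨e'⟩ := stable_equiv_ext_ker_of_subsingleton u π hex hsurj hP hd hT' 0
    exact ⟨(LinearEquiv.congrLeft ω R (eT (d + n))).trans
      ((zeroEquiv _ _).symm.trans (e'.symm.trans (eE (d + n))))⟩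
  · obtain ⟨e'⟩ := ext_zero_equiv_stable_zero u π hex hsurj hP i fun j hj => hT' j (by lia)
    exact ⟨(congrLeft e₀ (i + 1)).trans (e'.trans (eE i))⟩
  · have := subsingleton_stable_zero_of_le u π hex hsurj hP hd hT' k hk hkn
    exact (eE k).symm.toEquiv.subsingleton
  · obtain ⟨f₁, f₂, f₃, f₄, h₁, h₂, h₃, h₄⟩ := exists_exact_descending u π hex hsurj hP hd hT'
    obtain ⟨g₁, g₂, g₃, g₄, k₁, k₂, k₃, k₄, -⟩ := exists_exact_of_linearEquiv
      (congrLeft (eT (d + n)).symm 1) (eE (d + n + 1))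
      (LinearEquiv.congrLeft ω R (eT (d + n + 1)).symm)
      (congrLeft (eT (d + n)).symm 2) (eE (d + n + 2)) f₁ f₂ f₃ f₄ h₁ h₂ h₃
    exact ⟨g₁, g₂, g₃, g₄, k₄ h₄, k₁, k₂, k₃⟩

variable {R : Type u} [CommRing R] [IsNoetherianRing R] {ω M N : Type u}
  [AddCommGroup ω] [Module R ω] [AddCommGroup M] [Module R M] [Module.Finite R M]
  [AddCommGroup N] [Module R N] {d : ℕ}
  (hd : ∀ (X : Type u) [AddCommGroup X] [Module R X] [Module.Finite R X], ∀ p, d < p →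
    Subsingleton (ExtModule R X ω p))
  (hN : ∀ p, 1 ≤ p → Subsingleton (ExtModule R N ω p))

include hd hN

/-- In `0 → Hom(M, N) → G^0 → G^1 → C → 0` with `G = Hom(F, N)`, vanishing of `Ext^j(M, N)` up to
`d` forces all higher `Ext` of `C` into `ω` to vanish. The sequence therefore stays exact under
`Hom(-, ω)`, and `Hom(M, N)†` is the cokernel of `F_1 ⊗ N† → F_0 ⊗ N†`. -/
theorem nonempty_tensor_dual_equiv [Module.Finite R N]
    (hMN : ∀ j, 1 ≤ j → j ≤ d → Subsingleton (ExtModule R M N j)) :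
    Nonempty ((M ⊗[R] (N →ₗ[R] ω)) ≃ₗ[R] ((M →ₗ[R] N) →ₗ[R] ω)) := by
  obtain ⟨F⟩ := FiniteFreeResolution.nonempty (R := R) M
  have hC := subsingleton_ext_of_ker_subsingleton (Y := ω) (F.homCok N)
    (fun q => (LinearMap.range (LinearMap.lcomp R N (F.d (q + 1)))).mkQ)
    (fun q => exact_cokMap_mkQ _ _ _) (fun q => Submodule.mkQ_surjective _)
    (fun q p hp => subsingleton_hom_fin _ p (hN p hp)) hd
    (fun j hj => by
      obtain ⟨e⟩ := F.nonempty_ext_equiv N j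
      have := hMN (j + 1) (by lia) (by lia)
      exact e.symm.toEquiv.subsingleton)
  obtain ⟨e₁⟩ := stable_equiv_ext_ker (Y := ω) (LinearMap.lcomp R N (F.d 0))
    (LinearMap.range (LinearMap.lcomp R N (F.d 0))).mkQ
    (fun x => (Submodule.Quotient.mk_eq_zero _)) (Submodule.mkQ_surjective _)
    (fun p hp => subsingleton_hom_fin _ p (hN p hp)) 0 (hC 1 le_rfl) (hC 2 (by lia))
  obtain ⟨e₂⟩ := F.nonempty_stable_lcomp_equiv N ω
  obtain ⟨e₃⟩ := F.nonempty_hom_equiv N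
  exact ⟨e₂.trans (e₁.trans ((zeroEquiv _ _).trans (LinearEquiv.congrLeft ω R e₃.symm)))⟩

theorem tor_of_subsingleton_ext [Module.Finite R N] (n : ℕ)
    (hMN : ∀ j, 1 ≤ j → j ≤ d + n → Subsingleton (ExtModule R M N j)) :
    Nonempty (ExtModule R (ExtModule R M N (d + n + 1)) ω d ≃ₗ[R]
      TorModule R M (N →ₗ[R] ω) (n + 1)) ∧
    (∀ i : ℕ, 1 ≤ i → i ≤ n → Subsingleton (TorModule R M (N →ₗ[R] ω) i)) ∧
    ∃ (f₁ : TorModule R M (N →ₗ[R] ω) (n + 3) →ₗ[R]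
          extInt R (ExtModule R M N (d + n + 1)) ω ((d : ℤ) - 2))
      (f₂ : extInt R (ExtModule R M N (d + n + 1)) ω ((d : ℤ) - 2) →ₗ[R]
          ExtModule R (ExtModule R M N (d + n + 2)) ω d)
      (f₃ : ExtModule R (ExtModule R M N (d + n + 2)) ω d →ₗ[R]
          TorModule R M (N →ₗ[R] ω) (n + 2))
      (f₄ : TorModule R M (N →ₗ[R] ω) (n + 2) →ₗ[R]
          extInt R (ExtModule R M N (d + n + 1)) ω ((d : ℤ) - 1)),
      Function.Exact f₁ f₂ ∧ Function.Exact f₂ f₃ ∧ Function.Exact f₃ f₄ ∧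
        Function.Surjective f₄ := by
  obtain ⟨F⟩ := FiniteFreeResolution.nonempty (R := R) M
  have hP : ∀ q p, 1 ≤ p →
      Subsingleton (ExtModule R ((Fin (F.rank (q + 1 + 1)) → R) →ₗ[R] N) ω p) :=
    fun q p hp => subsingleton_hom_fin _ p (hN p hp)
  have hex : ∀ q, Function.Exact (F.homCok N q)
      (LinearMap.range (LinearMap.lcomp R N (F.d (q + 1)))).mkQ := fun q => exact_cokMap_mkQ _ _ _
  have hsurj : ∀ q, Function.Surjective
      (LinearMap.range (LinearMap.lcomp R N (F.d (q + 1)))).mkQ :=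
    fun q => Submodule.mkQ_surjective _
  have hH : ∀ j < d + n, Subsingleton (LinearMap.ker (F.homCok N j)) := fun j hj => by
    obtain ⟨e⟩ := F.nonempty_ext_equiv N j
    have := hMN (j + 1) (by lia) (by lia)
    exact e.symm.toEquiv.subsingleton
  have eE := fun q => (F.nonempty_ext_equiv N q).some
  have eT := fun q => (F.nonempty_stable_homCok_equiv N ω q).some
  refine ⟨?_, fun i hi hin => ?_, ?_⟩
  · obtain ⟨e⟩ := ext_ker_equiv_stable_zero (Y := ω) (F.homCok N) _ hex hsurj hP hd hH
    exact ⟨(congrLeft (eE _) d).trans (e.trans (eT n))⟩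
  · obtain ⟨i, rfl⟩ := Nat.exists_eq_add_of_le' hi
    have := subsingleton_stable_zero (Y := ω) (F.homCok N) _ hex hsurj hP hd hH i (by lia)
    exact (eT i).symm.toEquiv.subsingleton
  · obtain ⟨f₁, f₂, f₃, f₄, h₁, h₂, h₃, h₄⟩ :=
      exists_exact_ascending (Y := ω) (F.homCok N) _ hex hsurj hP hd hH
    obtain ⟨e₂⟩ := extInt_congr (Y := ω) (eE (d + n)).symm ((d : ℤ) - 2)
    obtain ⟨e₅⟩ := extInt_congr (Y := ω) (eE (d + n)).symm ((d : ℤ) - 1)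
    obtain ⟨g₁, g₂, g₃, g₄, k₁, k₂, k₃, -, k₄⟩ := exists_exact_of_linearEquiv (eT (n + 2)) e₂
      (congrLeft (eE (d + n + 1)).symm d) (eT (n + 1)) e₅ f₁ f₂ f₃ f₄ h₁ h₂ h₃
    exact ⟨g₁, g₂, g₃, g₄, k₁, k₂, k₃, k₄ h₄⟩

/-- To be applied with `N†` in the role of `N`; then `e` is biduality. Degree `i = 0` is tensor-hom
adjunction, since the shifts reach only positive degrees. -/
theorem ext_of_subsingleton_tor [Module.Finite R N] {N' : Type u} [AddCommGroup N'] [Module R N']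
    (e : (N →ₗ[R] ω) ≃ₗ[R] N') (n : ℕ)
    (hMN : ∀ j, 1 ≤ j → j ≤ d + n → Subsingleton (TorModule R M N j)) :
    Nonempty ((TorModule R M N (d + n + 1) →ₗ[R] ω) ≃ₗ[R] ExtModule R M N' (d + n + 1)) ∧
    (∀ i : ℕ, i ≤ d → Nonempty (ExtModule R (M ⊗[R] N) ω i ≃ₗ[R] ExtModule R M N' i)) ∧
    (∀ k : ℕ, d + 1 ≤ k → k ≤ d + n → Subsingleton (ExtModule R M N' k)) ∧
    ∃ (g₁ : ExtModule R (TorModule R M N (d + n + 1)) ω 1 →ₗ[R] ExtModule R M N' (d + n + 2))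
      (g₂ : ExtModule R M N' (d + n + 2) →ₗ[R] (TorModule R M N (d + n + 2) →ₗ[R] ω))
      (g₃ : (TorModule R M N (d + n + 2) →ₗ[R] ω) →ₗ[R]
          ExtModule R (TorModule R M N (d + n + 1)) ω 2)
      (g₄ : ExtModule R (TorModule R M N (d + n + 1)) ω 2 →ₗ[R] ExtModule R M N' (d + n + 3)),
      Function.Injective g₁ ∧ Function.Exact g₁ g₂ ∧ Function.Exact g₂ g₃ ∧
        Function.Exact g₃ g₄ := by
  obtain ⟨F⟩ := FiniteFreeResolution.nonempty (R := R) M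
  have hP : ∀ q p, 1 ≤ p → Subsingleton (ExtModule R ((Fin (F.rank q) → R) ⊗[R] N) ω p) :=
    fun q p hp => subsingleton_fin_tensor _ p (hN p hp)
  have eT := fun q => (F.nonempty_tor_equiv N q).some
  have eE := fun q => (F.nonempty_stable_tensorCok_equiv N e q).some
  obtain ⟨e₀⟩ : Nonempty ((M ⊗[R] N) ≃ₗ[R]
      (((Fin (F.rank 0) → R) ⊗[R] N) ⧸ LinearMap.range (LinearMap.rTensor N (F.d 0)))) :=
    LinearMap.nonempty_linearEquiv_of_surjective (LinearMap.rTensor N F.ε)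
      (LinearMap.range (LinearMap.rTensor N (F.d 0))).mkQ
      (LinearMap.rTensor_surjective _ F.ε_surjective) (Submodule.mkQ_surjective _) fun x => by
      rw [rTensor_exact _ F.exact_zero F.ε_surjective x, Submodule.mkQ_apply,
        Submodule.Quotient.mk_eq_zero]
      rfl
  obtain ⟨h₁, h₂, h₃, h₄⟩ := cohomology_of_subsingleton_homology
    (K := fun q => (Fin (F.rank q) → R) ⊗[R] N) (T := fun q => TorModule R M N (q + 1))
    (E := fun q => ExtModule R M N' (q + 1)) (fun q => LinearMap.rTensor N (F.d q)) (F.rTensor_d_comp_d N) hP eT eE e₀ hd (n := n)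
    fun j hj => hMN (j + 1) (by lia) (by lia)
  refine ⟨h₁, fun i hi => ?_, fun k hk hkn => ?_, h₄⟩
  · rcases i with _ | i
    · exact ⟨(zeroEquiv _ _).trans ((TensorProduct.lift.equiv (RingHom.id R) M N ω).symm.trans
        ((LinearEquiv.congrRight e).trans (zeroEquiv _ _).symm))⟩
    · exact h₂ i hi
  · obtain ⟨k, rfl⟩ := Nat.exists_eq_add_of_le' (show 1 ≤ k by lia)
    exact h₃ k (by lia) (by lia)

end ExtModule
end

/-! ### Depth, and the bound on injective dimension. -/

noncomputable section

open IsLocalRing RingTheory.Sequence Pointwise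

section Local

variable {R : Type u} [CommRing R] [IsLocalRing R]

lemma exists_isRegular_of_moduleDepth_eq {M : Type u} [AddCommGroup M] [Module R M]
    [Nontrivial M] {d : ℕ} (h : moduleDepth R M = d) :
    ∃ rs : List R, rs.length = d ∧ (∀ r ∈ rs, r ∈ maximalIdeal R) ∧ IsRegular M rs := by
  have : Nonempty {rs : List R // (∀ r ∈ rs, r ∈ maximalIdeal R) ∧ IsRegular M rs} :=
    ⟨⟨[], by simp, IsRegular.nil R M⟩⟩
  unfold moduleDepth at h
  obtain ⟨⟨rs, h₁, h₂⟩, h₃⟩ := ENat.exists_eq_iSup_of_lt_top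
    (f := fun rs : {rs : List R // (∀ r ∈ rs, r ∈ maximalIdeal R) ∧ IsRegular M rs} =>
      (rs.1.length : ℕ∞)) (by rw [h]; exact ENat.natCast_lt_top d)
  rw [h] at h₃
  exact ⟨rs, by exact_mod_cast h₃, h₁, h₂⟩

lemma length_le_moduleDepth {M : Type u} [AddCommGroup M] [Module R M] {rs : List R}
    (h₁ : ∀ r ∈ rs, r ∈ maximalIdeal R) (h₂ : IsRegular M rs) :
    (rs.length : ℕ∞) ≤ moduleDepth R M :=
  le_iSup (fun rs : {rs : List R // (∀ r ∈ rs, r ∈ maximalIdeal R) ∧ IsRegular M rs} =>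
      (rs.1.length : ℕ∞)) ⟨rs, h₁, h₂⟩

lemma subsingleton_of_smul_surjective {E : Type*} [AddCommGroup E] [Module R E]
    [Module.Finite R E] {r : R} (hr : r ∈ maximalIdeal R)
    (h : ∀ x : E, ∃ y : E, r • y = x) : Subsingleton E := by
  have htop : (⊤ : Submodule R E) = ⊥ := by
    refine Submodule.eq_bot_of_le_smul_of_le_jacobson_bot (maximalIdeal R) ⊤ Module.Finite.fg_top
      ?_ (IsLocalRing.maximalIdeal_le_jacobson _)
    intro x _
    obtain ⟨y, rfl⟩ := h x
    exact Submodule.smul_mem_smul hr trivial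
  exact (Submodule.subsingleton_iff R).mp (subsingleton_of_bot_eq_top htop.symm)

namespace ExtModule

variable {X Y : Type u} [AddCommGroup X] [Module R X] [AddCommGroup Y] [Module R Y]

omit [IsLocalRing R] in
lemma pre_lsmul (r : R) (n : ℕ) (x : ExtModule R X Y n) :
    pre Y (LinearMap.lsmul R X r) n x = r • x :=
  pre_smul_id r n x

/-- If `r` is regular on `X` and `Ext^{i+1}(X/rX, Y) = 0`, then `Ext^i(X, Y) = 0`. -/
lemma subsingleton_of_quotSMulTop [IsNoetherianRing R] [Module.Finite R X] [Module.Finite R Y]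
    {r : R} (hr : r ∈ maximalIdeal R) (hreg : IsSMulRegular X r) (i : ℕ)
    (h : Subsingleton (ExtModule R (QuotSMulTop r X) Y (i + 1))) :
    Subsingleton (ExtModule R X Y i) := by
  have : Module.Finite R (ModuleCat.of R X) := ‹Module.Finite R X›
  have : Module.Finite R (ModuleCat.of R Y) := ‹Module.Finite R Y›
  -- Multiplication by `r` is surjective on `Ext^i(X, Y)`, so Nakayama applies.
  have hs := pre_surjective (Y := Y) (LinearMap.lsmul R X r) (r • (⊤ : Submodule R X)).mkQ hreg
    (LinearMap.exact_lsmul_mkQ_smul_top X r) (Submodule.mkQ_surjective _) i h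
  exact subsingleton_of_smul_surjective hr fun x =>
    (hs x).imp fun y hy => (pre_lsmul r i y).symm.trans hy

/-- A module with a long regular sequence has few nonzero `Ext` into modules of finite injective
dimension. -/
theorem subsingleton_of_isWeaklyRegular [IsNoetherianRing R] [Module.Finite R Y] {d : ℕ}
    (hd : ∀ (X : Type u) [AddCommGroup X] [Module R X] [Module.Finite R X], ∀ p, d < p →
      Subsingleton (ExtModule R X Y p)) (rs : List R) (hrs : ∀ r ∈ rs, r ∈ maximalIdeal R) :
    ∀ (X : Type u) [AddCommGroup X] [Module R X] [Module.Finite R X], IsWeaklyRegular X rs →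
      ∀ i, d < i + rs.length → Subsingleton (ExtModule R X Y i) := by
  induction rs with
  | nil =>
    intro X _ _ _ _ i hi
    exact hd X i hi
  | cons r rs ih =>
    intro X _ _ _ hreg i hi
    rw [isWeaklyRegular_cons_iff] at hreg
    rw [List.length_cons] at hi
    exact subsingleton_of_quotSMulTop (hrs r (by simp)) hreg.1 i
      (ih (fun s hs => hrs s (by simp [hs])) _ hreg.2 (i + 1) (by lia))

omit [IsLocalRing R] in
/-- `Ext` out of the quotient by a regular sequence. -/
lemma subsingleton_quotient_of_isWeaklyRegular (rs : List R) :
    ∀ (X : Type u) [AddCommGroup X] [Module R X], IsWeaklyRegular X rs → ∀ t : ℕ,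
      (∀ i, t < i → Subsingleton (ExtModule R X Y i)) →
      ∀ i, t + rs.length < i →
        Subsingleton (ExtModule R (X ⧸ (Ideal.ofList rs • ⊤ : Submodule R X)) Y i) := by
  induction rs with
  | nil =>
    intro X _ _ _ t ht i hi
    have := ht i (by simpa using hi)
    exact (congrLeft (Submodule.quotEquivOfEqBot (Ideal.ofList [] • ⊤ : Submodule R X)
      (by simp)) i).toEquiv.subsingleton
  | cons r rs ih =>
    intro X _ _ hreg t ht i hi
    rw [isWeaklyRegular_cons_iff] at hreg
    rw [List.length_cons] at hi
    have : Subsingleton (ExtModule R (QuotSMulTop r X ⧸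
        (Ideal.ofList rs • ⊤ : Submodule R (QuotSMulTop r X))) Y i) := by
      refine ih (QuotSMulTop r X) hreg.2 (t + 1) (fun j hj => ?_) i (by lia)
      obtain ⟨j, rfl⟩ := Nat.exists_eq_add_of_le' (show 1 ≤ j by lia)
      exact subsingleton_right (Y := Y) (LinearMap.lsmul R X r) (r • (⊤ : Submodule R X)).mkQ
        hreg.1 (LinearMap.exact_lsmul_mkQ_smul_top X r) (Submodule.mkQ_surjective _) j
        (ht j (by lia)) (ht (j + 1) (by lia))
    exact (congrLeft (Submodule.quotOfListConsSMulTopEquivQuotSMulTopInner X r rs)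
      i).toEquiv.subsingleton

end ExtModule

/-- If the depth of `R` is `rs.length`, the residue field embeds into the quotient of `R` by the
regular sequence `rs`. -/
lemma exists_residue_injective [IsNoetherianRing R] {rs : List R}
    (hrs : ∀ r ∈ rs, r ∈ maximalIdeal R) (hreg : IsRegular R rs)
    (hdepth : moduleDepth R R = rs.length) :
    ∃ f : (R ⧸ maximalIdeal R) →ₗ[R] (R ⧸ (Ideal.ofList rs • ⊤ : Submodule R R)),
      Function.Injective f := by
  by_contra! hcon
  have hzero : ∀ f : (R ⧸ maximalIdeal R) →ₗ[R] (R ⧸ (Ideal.ofList rs • ⊤ : Submodule R R)),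
      f = 0 := fun f => by
    have : IsSimpleModule R (R ⧸ maximalIdeal R) :=
      isSimpleModule_iff_isCoatom.mpr (Ideal.isMaximal_def.mp inferInstance)
    exact (LinearMap.injective_or_eq_zero f).resolve_left (hcon f)
  have hnt : Nontrivial (R ⧸ (Ideal.ofList rs • ⊤ : Submodule R R)) :=
    hreg.quot_ofList_smul_nontrivial ⊤
  -- If no map from the residue field is nonzero, Rees's criterion gives one more regular element,
  -- and `rs` could be prolonged beyond the depth.
  obtain ⟨ss, hlen, hss, hsreg⟩ := ModuleCat.exists_isRegular_of_exists_subsingleton_ext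
    (maximalIdeal R) 1 (ModuleCat.of R (R ⧸ (Ideal.ofList rs • ⊤ : Submodule R R)))
    (lt_top_iff_ne_top.mpr fun h => by
      have := Submodule.eq_bot_of_le_smul_of_le_jacobson_bot (maximalIdeal R) _
        Module.Finite.fg_top h.ge (IsLocalRing.maximalIdeal_le_jacobson _)
      exact bot_ne_top this.symm)
    (ModuleCat.of R (R ⧸ maximalIdeal R))
    (by
      change Module.support R (R ⧸ maximalIdeal R) = _
      rw [Module.support_eq_zeroLocus, Ideal.annihilator_quotient])
    (fun i hi => by
      obtain rfl : i = 0 := by lia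
      have : Subsingleton ((R ⧸ maximalIdeal R) →ₗ[R]
        (R ⧸ (Ideal.ofList rs • ⊤ : Submodule R R))) := subsingleton_of_forall_eq 0 hzero
      exact (ExtModule.zeroEquiv (R ⧸ maximalIdeal R)
        (R ⧸ (Ideal.ofList rs • ⊤ : Submodule R R))).toEquiv.subsingleton)
  have hmem : ∀ r ∈ rs ++ ss, r ∈ maximalIdeal R := by
    intro r hr
    rcases List.mem_append.mp hr with h | h
    exacts [hrs r h, hss r h]
  have hreg' : IsRegular R (rs ++ ss) :=
    (IsLocalRing.isRegular_iff_isWeaklyRegular_of_subset_maximalIdeal hmem).mpr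
      ((isWeaklyRegular_append_iff R rs ss).mpr ⟨hreg.1, hsreg.1⟩)
  have := length_le_moduleDepth hmem hreg'
  rw [hdepth, List.length_append, hlen] at this
  norm_cast at this
  lia

/-- A finitely generated module of finite injective dimension has injective dimension at most the
depth of the ring. -/
theorem subsingleton_ext_of_depth_lt [IsNoetherianRing R] {Y : Type u} [AddCommGroup Y]
    [Module R Y] [Module.Finite R Y] {d : ℕ} (hR : moduleDepth R R = d)
    (hY : ∃ n : ℕ, HasInjectiveDimensionLE (ModuleCat.of R Y) n) :
    ∀ (X : Type u) [AddCommGroup X] [Module R X] [Module.Finite R X], ∀ p, d < p →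
      Subsingleton (ExtModule R X Y p) := by
  obtain ⟨rs, hlen, hrs, hreg⟩ := exists_isRegular_of_moduleDepth_eq hR
  obtain ⟨f, hf⟩ := exists_residue_injective hrs hreg (by rw [hR, hlen])
  have hquot := ExtModule.subsingleton_quotient_of_isWeaklyRegular (Y := Y) rs R hreg.1 0
    fun i hi => ExtModule.subsingleton_of_projective i hi
  -- Descending induction from the given finite injective dimension. Prime filtrations reduce to `R
  -- ⧸ p`. For `p` not maximal, an element of the maximal ideal outside `p` is regular and
  -- `subsingleton_of_quotSMulTop` applies; for the residue field, embed it in `R ⧸ (rs)`, which has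
  -- no `Ext` above `d`.
  have hstep : ∀ r, d < r → (∀ (X : Type u) [AddCommGroup X] [Module R X] [Module.Finite R X],
      Subsingleton (ExtModule R X Y (r + 1))) →
      ∀ (X : Type u) [AddCommGroup X] [Module R X] [Module.Finite R X],
      Subsingleton (ExtModule R X Y r) := by
    intro r hr h X _ _ hX
    induction hX using IsNoetherianRing.induction_on_isQuotientEquivQuotientPrime R with
    | subsingleton N => exact ExtModule.subsingleton_of_subsingleton r
    | quotient N p e =>
      have : Subsingleton (ExtModule R (R ⧸ p.asIdeal) Y r) := by
        by_cases hp : p.asIdeal = maximalIdeal R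
        · rw [hp]
          exact ExtModule.subsingleton_left f (LinearMap.range f).mkQ hf
            (LinearMap.exact_map_mkQ_range f) (Submodule.mkQ_surjective _) r
            (hquot r (by rw [hlen]; lia)) (h _)
        · obtain ⟨x, hx, hxp⟩ := SetLike.exists_of_lt
            (lt_of_le_of_ne (IsLocalRing.le_maximalIdeal p.2.ne_top) hp)
          refine ExtModule.subsingleton_of_quotSMulTop hx (fun a b hab => ?_) r (h _)
          obtain ⟨a, rfl⟩ := Ideal.Quotient.mk_surjective a
          obtain ⟨b, rfl⟩ := Ideal.Quotient.mk_surjective b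
          have hab' : Ideal.Quotient.mk p.asIdeal (x * a) = Ideal.Quotient.mk p.asIdeal (x * b) :=
            hab
          rw [Ideal.Quotient.eq, ← mul_sub] at hab'
          exact Ideal.Quotient.eq.mpr ((p.2.mem_or_mem hab').resolve_left hxp)
      exact (ExtModule.congrLeft e r).toEquiv.subsingleton
    | exact N₁ N₂ N₃ f g hf hg hfg h₁ h₃ =>
      exact ExtModule.subsingleton_middle f g hf hfg hg r h₁ h₃
  obtain ⟨n, hn⟩ := hY
  have key : ∀ k p, d < p → n < p + k →
      ∀ (X : Type u) [AddCommGroup X] [Module R X] [Module.Finite R X],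
        Subsingleton (ExtModule R X Y p) := by
    intro k
    induction k with
    | zero =>
      intro p _ hp X _ _ _
      exact HasInjectiveDimensionLT.subsingleton _ (n + 1) p (by lia) _
    | succ k ih =>
      intro p hp hpk
      exact hstep p hp (ih (p + 1) (by lia) (by lia))
  intro X _ _ _ p hp
  exact key (n + 1) p hp (by lia) X

end Local
end

/-! ### The endomorphism ring of the canonical module is `R`. -/

noncomputable section

open IsLocalRing RingTheory.Sequence Pointwise

section ScalarEnd

variable {R : Type u} [CommRing R]

/-- Every endomorphism of `W` is a homothety, and the annihilator of `W` is contained in `I`. -/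
def HasScalarEnd (I : Ideal R) (W : Type u) [AddCommGroup W] [Module R W] : Prop :=
  (∀ φ : W →ₗ[R] W, ∃ r : R, φ = r • LinearMap.id) ∧ ∀ r : R, (∀ x : W, r • x = 0) → r ∈ I

variable {W : Type u} [AddCommGroup W] [Module R W]

/-- The module `R` is the endomorphism module of a faithful module with only scalar
endomorphisms. -/
lemma HasScalarEnd.nonempty_equiv (h : HasScalarEnd (⊥ : Ideal R) W) :
    Nonempty (R ≃ₗ[R] (W →ₗ[R] W)) := by
  refine ⟨LinearEquiv.ofBijective (LinearMap.toSpanSingleton R (W →ₗ[R] W) LinearMap.id)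
    ⟨(injective_iff_map_eq_zero _).mpr fun r hr => ?_, fun φ => ?_⟩⟩
  · exact h.2 r fun x => LinearMap.congr_fun hr x
  · obtain ⟨r, rfl⟩ := h.1 φ
    exact ⟨r, rfl⟩

/-- Scalar endomorphisms lift along the quotient by a regular element. -/
lemma HasScalarEnd.of_quotSMulTop [IsLocalRing R] [IsNoetherianRing R] [Module.Finite R W]
    {I : Ideal R} (hI : ∀ r ∈ I, ∀ x : W, r • x = 0) {r : R} (hr : r ∈ maximalIdeal R)
    (hreg : IsSMulRegular W r) (h : HasScalarEnd (I ⊔ Ideal.span {r}) (QuotSMulTop r W)) :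
    HasScalarEnd I W := by
  have hmem : ∀ x : W, (Submodule.Quotient.mk x : QuotSMulTop r W) = 0 → ∃ y : W, r • y = x := by
    intro x hx
    have := (Submodule.Quotient.mk_eq_zero _).mp hx
    rw [Submodule.mem_smul_pointwise_iff_exists] at this
    obtain ⟨y, -, hy⟩ := this
    exact ⟨y, hy⟩
  constructor
  -- Nakayama in `End W`: modulo `r` an endomorphism `φ` is a scalar `s`, and `φ - s = r ψ` with `ψ`
  -- linear because `r` is regular.
  · have htop : (⊤ : Submodule R (W →ₗ[R] W)) ≤ Submodule.span R {LinearMap.id} := by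
      refine Submodule.le_of_le_smul_of_le_jacobson_bot (I := maximalIdeal R)
        (IsNoetherian.noetherian _) (IsLocalRing.maximalIdeal_le_jacobson _) ?_
      intro φ _
      obtain ⟨s, hs⟩ := h.1 (QuotSMulTop.map r φ)
      have hex : ∀ x : W, ∃ y : W, r • y = φ x - s • x := fun x => hmem _ <| by
        have := LinearMap.congr_fun hs (Submodule.Quotient.mk x)
        rw [Submodule.Quotient.mk_sub, sub_eq_zero]
        exact this
      choose ψ hψ using hex
      let ψ' : W →ₗ[R] W :=
        { toFun := ψ
          map_add' := fun x y => hreg (by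
            change r • ψ (x + y) = r • (ψ x + ψ y)
            rw [smul_add, hψ, hψ, hψ, map_add, smul_add]; abel)
          map_smul' := fun a x => hreg (by
            change r • ψ (a • x) = r • (a • ψ x)
            rw [smul_comm r a, hψ, hψ, map_smul, smul_sub, smul_comm a s]) }
      have : φ = s • LinearMap.id + r • ψ' := by
        ext x
        change φ x = s • x + r • ψ x
        rw [hψ]; abel
      rw [this]
      exact Submodule.add_mem_sup (Submodule.smul_mem _ _ (Submodule.mem_span_singleton_self _))
        (Submodule.smul_mem_smul hr trivial)
    intro φ
    obtain ⟨s, hs⟩ := Submodule.mem_span_singleton.mp (htop (Submodule.mem_top (x := φ)))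
    exact ⟨s, hs.symm⟩
  -- Nakayama again: if `i + c r` kills `W` with `i ∈ I`, then `c r` kills `W`, and hence so does
  -- `c`.
  · have hle : Module.annihilator R W ≤ I := by
      refine Submodule.le_of_le_smul_of_le_jacobson_bot (I := maximalIdeal R)
        (IsNoetherian.noetherian _) (IsLocalRing.maximalIdeal_le_jacobson _) ?_
      intro a ha
      rw [Module.mem_annihilator] at ha
      have : a ∈ I ⊔ Ideal.span {r} := h.2 a fun x => by
        obtain ⟨x, rfl⟩ := Submodule.Quotient.mk_surjective _ x
        rw [← Submodule.Quotient.mk_smul, ha, Submodule.Quotient.mk_zero]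
      obtain ⟨i, hi, b, hb, rfl⟩ := Submodule.mem_sup.mp this
      obtain ⟨c, rfl⟩ := Ideal.mem_span_singleton'.mp hb
      refine Submodule.add_mem_sup hi ?_
      rw [mul_comm]
      refine Submodule.smul_mem_smul hr (Module.mem_annihilator.mpr fun x => hreg ?_)
      have := ha x
      rw [add_smul, hI i hi x, zero_add, mul_comm, mul_smul] at this
      simpa using this
    exact fun s hs => hle (Module.mem_annihilator.mpr hs)

end ScalarEnd

section Artinian

variable {R : Type u} [CommRing R] [IsLocalRing R] {E : Type u} [AddCommGroup E]
  [Module R E]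

/-- A module `E` over `R ⧸ I` into which maps extend and with one-dimensional socle detects
elements. -/
lemma exists_apply_ne_zero_of_extend {I : Ideal R}
    (hext : ∀ (X Y : Type u) [AddCommGroup X] [Module R X] [AddCommGroup Y] [Module R Y]
      [Module.Finite R X] [Module.Finite R Y], (∀ r ∈ I, ∀ y : Y, r • y = 0) →
      ∀ (f : X →ₗ[R] Y), Function.Injective f → ∀ φ : X →ₗ[R] E, ∃ ψ : Y →ₗ[R] E, ψ ∘ₗ f = φ)
    (hsoc : Nonempty (((R ⧸ maximalIdeal R) →ₗ[R] E) ≃ₗ[R] (R ⧸ maximalIdeal R)))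
    {X : Type u} [AddCommGroup X] [Module R X] [Module.Finite R X]
    (hX : ∀ r ∈ I, ∀ x : X, r • x = 0) {x : X} (hx : x ≠ 0) : ∃ ψ : X →ₗ[R] E, ψ x ≠ 0 := by
  obtain ⟨e⟩ := hsoc
  have hne : e.symm (Submodule.Quotient.mk 1) ≠ 0 := by
    rw [Ne, LinearEquiv.map_eq_zero_iff, Submodule.Quotient.mk_eq_zero]
    exact (Ideal.ne_top_iff_one _).mp (maximalIdeal.isMaximal R).ne_top
  set σ := e.symm (Submodule.Quotient.mk 1) with hσ
  have hσ1 : σ (Submodule.Quotient.mk 1) ≠ 0 := by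
    intro h
    apply hne
    ext
    simpa using h
  have hker : LinearMap.ker (LinearMap.toSpanSingleton R X x) ≤ maximalIdeal R :=
    IsLocalRing.le_maximalIdeal fun h => hx (by
      have : (1 : R) ∈ LinearMap.ker (LinearMap.toSpanSingleton R X x) := by rw [h]; trivial
      simpa using this)
  let f : (R ⧸ LinearMap.ker (LinearMap.toSpanSingleton R X x)) →ₗ[R] X :=
    Submodule.liftQ _ (LinearMap.toSpanSingleton R X x) le_rfl
  have hf : Function.Injective f := LinearMap.ker_eq_bot.mp (Submodule.ker_liftQ_eq_bot' _ _ rfl)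
  -- The cyclic module `R x` maps onto the residue field and then by `σ` into `E`, nontrivially at
  -- `x`; this map is extended to `X`.
  obtain ⟨ψ, hψ⟩ := hext _ X hX f hf (σ ∘ₗ Submodule.factor hker)
  refine ⟨ψ, fun h => hσ1 ?_⟩
  have := LinearMap.congr_fun hψ (Submodule.Quotient.mk 1)
  have hfx : f (Submodule.Quotient.mk 1) = x := by
    change LinearMap.toSpanSingleton R X x 1 = x
    simp
  rw [LinearMap.comp_apply, hfx, h] at this
  exact this.symm

/-- Duality into such a module preserves length. -/
lemma length_hom_eq_of_extend {I : Ideal R}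
    (hext : ∀ (X Y : Type u) [AddCommGroup X] [Module R X] [AddCommGroup Y] [Module R Y]
      [Module.Finite R X] [Module.Finite R Y], (∀ r ∈ I, ∀ y : Y, r • y = 0) →
      ∀ (f : X →ₗ[R] Y), Function.Injective f → ∀ φ : X →ₗ[R] E, ∃ ψ : Y →ₗ[R] E, ψ ∘ₗ f = φ)
    (hsoc : Nonempty (((R ⧸ maximalIdeal R) →ₗ[R] E) ≃ₗ[R] (R ⧸ maximalIdeal R)))
    {X : Type u} [AddCommGroup X] [Module R X] (hfl : IsFiniteLength R X)
    (hX : ∀ r ∈ I, ∀ x : X, r • x = 0) :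
    Module.length R (X →ₗ[R] E) = Module.length R X := by
  induction hfl with
  | of_subsingleton => simp [Module.length_eq_zero]
  | @of_simple_quotient X _ _ S hsimp hS ih =>
    have hfl : IsFiniteLength R X := IsFiniteLength.of_simple_quotient hS
    have hXn := (isFiniteLength_iff_isNoetherian_isArtinian.mp hfl).1
    have hih := ih fun r hr x => Subtype.ext (hX r hr x)
    -- The extension property makes the dual of `0 → S → X → X/S → 0` exact, and the simple quotient
    -- has a dual of length one.
    rw [Module.length_eq_add_of_exact (S.mkQ.lcomp R E) (S.subtype.lcomp R E)
      (LinearMap.lcomp_injective_of_surjective _ S.mkQ_surjective)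
      (fun φ => hext S X hX S.subtype S.injective_subtype φ)
      (LinearMap.exact_lcomp_of_exact_of_surjective E
        (LinearMap.exact_subtype_mkQ S) S.mkQ_surjective), hih,
      Module.length_eq_add_of_exact S.subtype S.mkQ S.injective_subtype S.mkQ_surjective
        (LinearMap.exact_subtype_mkQ S), add_comm]
    congr 1
    obtain ⟨J, hJ, ⟨e⟩⟩ := isSimpleModule_iff_quot_maximal.mp hsimp
    obtain rfl := IsLocalRing.eq_maximalIdeal hJ
    obtain ⟨s⟩ := hsoc
    rw [(e.congrLeft E R).length_eq, s.length_eq, e.length_eq]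

/-- Duality into an injective hull of the residue field of an Artinian ring: the endomorphisms are
the scalars. -/
theorem hasScalarEnd_of_extend [IsNoetherianRing R] [Module.Finite R E] {I : Ideal R}
    (hI : ∀ r ∈ I, ∀ x : E, r • x = 0)
    (hext : ∀ (X Y : Type u) [AddCommGroup X] [Module R X] [AddCommGroup Y] [Module R Y]
      [Module.Finite R X] [Module.Finite R Y], (∀ r ∈ I, ∀ y : Y, r • y = 0) →
      ∀ (f : X →ₗ[R] Y), Function.Injective f → ∀ φ : X →ₗ[R] E, ∃ ψ : Y →ₗ[R] E, ψ ∘ₗ f = φ)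
    (hsoc : Nonempty (((R ⧸ maximalIdeal R) →ₗ[R] E) ≃ₗ[R] (R ⧸ maximalIdeal R)))
    {n : ℕ} (hn : ∀ r ∈ maximalIdeal R ^ n, ∀ x : E, r • x = 0) : HasScalarEnd I E := by
  have hRI : ∀ r ∈ I, ∀ x : R ⧸ I, r • x = 0 := fun r hr x => by
    obtain ⟨x, rfl⟩ := Submodule.Quotient.mk_surjective _ x
    rw [← Submodule.Quotient.mk_smul, Submodule.Quotient.mk_eq_zero]
    exact I.mul_mem_right _ hr
  have hann : ∀ r : R, (∀ x : E, r • x = 0) → r ∈ I := fun r hr => by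
    by_contra hrI
    obtain ⟨ψ, hψ⟩ := exists_apply_ne_zero_of_extend hext hsoc hRI
      (x := Submodule.Quotient.mk r) (by rwa [Ne, Submodule.Quotient.mk_eq_zero])
    apply hψ
    have : (Submodule.Quotient.mk r : R ⧸ I) = r • Submodule.Quotient.mk 1 := by
      rw [← Submodule.Quotient.mk_smul, smul_eq_mul, mul_one]
    rw [this, map_smul, hr]
  refine ⟨?_, hann⟩
  by_cases hItop : I = ⊤
  · intro φ
    refine ⟨0, LinearMap.ext fun x => ?_⟩
    have h0 : ∀ y : E, y = 0 := fun y => by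
      simpa using hI 1 (hItop ▸ trivial) y
    exact (h0 _).trans (h0 _).symm
  have hpow : maximalIdeal R ^ n ≤ I := fun r hr => hann r (hn r hr)
  have hnt : Nontrivial (R ⧸ I) := Ideal.Quotient.nontrivial_iff.mpr hItop
  have hlocal : IsLocalRing (R ⧸ I) := .of_surjective' _ Ideal.Quotient.mk_surjective
  have hart : IsArtinianRing (R ⧸ I) := by
    rw [isArtinianRing_iff_isNilpotent_maximalIdeal]
    refine ⟨n, ?_⟩
    rw [← IsLocalRing.map_maximalIdeal_of_surjective _ Ideal.Quotient.mk_surjective,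
      ← Ideal.map_pow, Ideal.zero_eq_bot, Ideal.map_eq_bot_iff_le_ker, Ideal.mk_ker]
    exact hpow
  have hfl : IsFiniteLength R (R ⧸ I) :=
    isFiniteLength_iff_isNoetherian_isArtinian.mpr ⟨inferInstance,
      isArtinian_of_surjective_algebraMap (R := R ⧸ I) (S := R) (M := R ⧸ I)
        Ideal.Quotient.mk_surjective⟩
  let ev : ((R ⧸ I) →ₗ[R] E) ≃ₗ[R] E := LinearEquiv.ofBijective
    (LinearMap.applyₗ (Submodule.Quotient.mk 1 : R ⧸ I))
    ⟨fun φ ψ h => by ext; simpa using h, fun x =>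
      ⟨Submodule.liftQ I (LinearMap.toSpanSingleton R E x) fun r hr => by simp [hI r hr], by
        change LinearMap.toSpanSingleton R E x 1 = x
        simp⟩⟩
  have hE : Module.length R E = Module.length R (R ⧸ I) :=
    ev.length_eq.symm.trans (length_hom_eq_of_extend hext hsoc hfl hRI)
  have hEfl : IsFiniteLength R E := by
    rw [← Module.length_ne_top_iff, hE, Module.length_ne_top_iff]; exact hfl
  have hEE : Module.length R (E →ₗ[R] E) = Module.length R (R ⧸ I) :=
    (length_hom_eq_of_extend hext hsoc hEfl hI).trans hE
  let κ : (R ⧸ I) →ₗ[R] (E →ₗ[R] E) :=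
    Submodule.liftQ I (LinearMap.toSpanSingleton R (E →ₗ[R] E) LinearMap.id) fun r hr => by
      rw [LinearMap.mem_ker]
      ext x
      exact hI r hr x
  have hκ : Function.Injective κ := by
    rw [injective_iff_map_eq_zero]
    intro a ha
    obtain ⟨a, rfl⟩ := Submodule.Quotient.mk_surjective _ a
    rw [Submodule.Quotient.mk_eq_zero]
    exact hann a fun x => LinearMap.congr_fun ha x
  have hadd := Module.length_eq_add_of_exact κ (LinearMap.range κ).mkQ hκ
    (Submodule.mkQ_surjective _) (LinearMap.exact_map_mkQ_range κ)
  -- `R ⧸ I`, `E` and `End E` all have the same finite length, so the injection `κ` of scalars is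
  -- onto.
  have hzero : Module.length R ((E →ₗ[R] E) ⧸ LinearMap.range κ) = 0 := by
    rw [hEE] at hadd
    have := Module.length_ne_top_iff.mpr hfl
    revert hadd this
    generalize Module.length R (R ⧸ I) = a
    generalize Module.length R ((E →ₗ[R] E) ⧸ LinearMap.range κ) = b
    intro h ha
    lift a to ℕ using ha
    exact (WithTop.add_left_cancel (WithTop.natCast_ne_top a) ((add_zero _).trans h)).symm
  intro φ
  rw [Module.length_eq_zero_iff, Submodule.Quotient.subsingleton_iff] at hzero
  obtain ⟨a, ha⟩ : φ ∈ LinearMap.range κ := hzero ▸ trivial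
  obtain ⟨a, rfl⟩ := Submodule.Quotient.mk_surjective _ a
  exact ⟨a, ha.symm⟩

end Artinian

section Koszul

variable {R : Type u} [CommRing R] [IsNoetherianRing R]

lemma subsingleton_ext_of_isRegular {W X : Type u} [AddCommGroup W] [Module R W]
    [Module.Finite R W] [AddCommGroup X] [Module R X] [Module.Finite R X] {rs : List R}
    (hreg : IsRegular W rs) (hX : ∀ r ∈ rs, ∀ x : X, r • x = 0) {i : ℕ} (hi : i < rs.length) :
    Subsingleton (ExtModule R X W i) := by
  have : Module.Finite R (ModuleCat.of R X) := ‹Module.Finite R X›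
  have : Module.Finite R (ModuleCat.of R W) := ‹Module.Finite R W›
  refine ModuleCat.subsingleton_ext_of_exists_isRegular (Ideal.ofList rs) (ModuleCat.of R X) ?_
    (ModuleCat.of R W) (lt_top_iff_ne_top.mpr hreg.2.symm) rs
    (fun r hr => Ideal.subset_span hr) hreg i hi
  rw [Module.support_eq_zeroLocus]
  refine PrimeSpectrum.zeroLocus_anti_mono (Ideal.span_le.mpr fun r hr => ?_)
  exact Module.mem_annihilator.mpr (hX r hr)

/-- For a regular sequence `rs` on `W`, the functor `Ext^{rs.length}(-, W)` on modules killed by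
`rs` is represented by `W ⧸ rs W`. -/
theorem exists_ext_represents [IsLocalRing R] (rs : List R) (hrs : ∀ r ∈ rs, r ∈ maximalIdeal R) :
    ∀ (W : Type u) [AddCommGroup W] [Module R W] [Module.Finite R W], IsRegular W rs →
      ∃ (E : ModuleCat.{u} R) (η : Abelian.Ext.{u} E (ModuleCat.of R W) rs.length),
        Nonempty ((W ⧸ (Ideal.ofList rs • ⊤ : Submodule R W)) ≃ₗ[R] E) ∧
        (∀ (X : Type u) [AddCommGroup X] [Module R X] [Module.Finite R X],
          (∀ r ∈ rs, ∀ x : X, r • x = 0) →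
          Function.Bijective fun φ : X →ₗ[R] E =>
            ((Abelian.Ext.mk₀ (ModuleCat.ofHom φ)).comp η (zero_add _) :
              ExtModule R X W rs.length)) ∧
        ∀ I : Ideal R, (∀ r ∈ I, ∀ x : W, r • x = 0) →
          HasScalarEnd (I ⊔ Ideal.ofList rs) E → HasScalarEnd I W := by
  induction rs with
  | nil =>
    intro W _ _ _ _
    refine ⟨ModuleCat.of R W, Abelian.Ext.mk₀ (𝟙 _),
      ⟨Submodule.quotEquivOfEqBot (Ideal.ofList [] • ⊤ : Submodule R W) (by simp)⟩, ?_, ?_⟩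
    · intro X _ _ _ _
      refine (congrArg Function.Bijective (funext fun φ => ?_)).mpr
        (ExtModule.zeroEquiv X W).symm.bijective
      exact Abelian.Ext.comp_mk₀_id _
    · intro I _ h
      simpa using h
  | cons r rs ih =>
    intro W _ _ _ hreg
    have hreg' := (isRegular_cons_iff W r rs).mp hreg
    obtain ⟨E, η, ⟨e⟩, hη, hE⟩ := ih (fun s hs => hrs s (by simp [hs])) (QuotSMulTop r W) hreg'.2
    have hS := IsSMulRegular.smulShortComplex_shortExact (M := ModuleCat.of R W) hreg'.1
    -- The universal class is spliced with the extension `0 → W → W → W/rW → 0`. `E` is only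
    -- isomorphic to `W ⧸ (r, rs)W`, being obtained by successive quotients.
    refine ⟨E, η.comp hS.extClass rfl,
      ⟨(Submodule.quotOfListConsSMulTopEquivQuotSMulTopInner W r rs).trans e⟩, ?_, ?_⟩
    · intro X _ _ _ hX
      have hb : Function.Bijective fun x : ExtModule R X (QuotSMulTop r W) rs.length =>
          (x.comp hS.extClass rfl : ExtModule R X W (rs.length + 1)) := by
        constructor
        · have : Subsingleton (ExtModule R X W rs.length) :=
            subsingleton_ext_of_isRegular hreg hX (by simp)
          refine (injective_iff_map_eq_zero
            (hS.extClass.postcomp (ModuleCat.of R X) (rfl : rs.length + 1 = _))).mpr ?_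
          intro x hx
          obtain ⟨y, rfl⟩ := Abelian.Ext.covariant_sequence_exact₃ _ hS x rfl hx
          rw [show y = 0 from Subsingleton.elim (α := ExtModule R X W rs.length) _ _,
            Abelian.Ext.zero_comp]
        · intro x
          refine Abelian.Ext.covariant_sequence_exact₁ _ hS x ?_ rfl
          -- As `r` kills `X` it kills `Ext(X, W)`, so every class comes from the connecting map.
          have h0 : LinearMap.lsmul R X r = (0 : R) • LinearMap.id := by
            ext y
            simpa using hX r (by simp) y
          have := ExtModule.pre_lsmul r _ (show ExtModule R X W (rs.length + 1) from x)
          rw [h0, ExtModule.pre_smul_id, zero_smul] at this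
          exact (Abelian.Ext.smul_eq_comp_mk₀ (show ExtModule R X W (rs.length + 1) from x)
            r).symm.trans this.symm
      have := hb.comp (hη X fun s hs => hX s (by simp [hs]))
      refine (congrArg Function.Bijective (funext fun φ => ?_)).mpr this
      exact (Abelian.Ext.comp_assoc (Abelian.Ext.mk₀ (ModuleCat.ofHom φ)) η hS.extClass
        (zero_add _) rfl (by simp)).symm
    · intro I hI h
      refine HasScalarEnd.of_quotSMulTop hI (hrs r (by simp)) hreg'.1 (hE _ ?_ ?_)
      · intro s hs x
        obtain ⟨x, rfl⟩ := Submodule.Quotient.mk_surjective _ x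
        obtain ⟨i, hi, b, hb, rfl⟩ := Submodule.mem_sup.mp hs
        obtain ⟨c, rfl⟩ := Ideal.mem_span_singleton'.mp hb
        rw [← Submodule.Quotient.mk_smul, add_smul, hI i hi, zero_add,
          Submodule.Quotient.mk_eq_zero, mul_comm, mul_smul]
        exact Submodule.smul_mem_pointwise_smul _ _ _ trivial
      · rwa [sup_assoc, ← Ideal.ofList_cons]

/-- A module of dimension zero over a Noetherian local ring is killed by a power of the maximal
ideal. -/
lemma exists_pow_smul_eq_zero_of_supportDim_eq_zero [IsLocalRing R] {E : Type u} [AddCommGroup E]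
    [Module R E] [Module.Finite R E] (h : Module.supportDim R E = 0) :
    ∃ n : ℕ, ∀ r ∈ maximalIdeal R ^ n, ∀ x : E, r • x = 0 := by
  have hsupp := support_of_supportDim_eq_zero R E h
  have hle : maximalIdeal R ≤ (Module.annihilator R E).radical := by
    rw [← PrimeSpectrum.zeroLocus_subset_zeroLocus_iff, ← Module.support_eq_zeroLocus, hsupp]
  obtain ⟨n, hn⟩ := Ideal.exists_pow_le_of_le_radical_of_fg hle (IsNoetherian.noetherian _)
  exact ⟨n, fun r hr => Module.mem_annihilator.mp (hn hr)⟩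

/-- The endomorphisms of a canonical module are the scalars. -/
theorem IsCanonicalModule.hasScalarEnd [IsLocalRing R] {ω : Type u} [AddCommGroup ω] [Module R ω]
    (hω : IsCanonicalModule R ω) {d : ℕ} (hdepth : moduleDepth R ω = d)
    (hd : ∀ (X : Type u) [AddCommGroup X] [Module R X] [Module.Finite R X], ∀ p, d < p →
      Subsingleton (ExtModule R X ω p)) : HasScalarEnd (⊥ : Ideal R) ω := by
  have := hω.nontrivial
  have := hω.finite
  obtain ⟨rs, rfl, hrs, hreg⟩ := exists_isRegular_of_moduleDepth_eq hdepth
  obtain ⟨E, η, ⟨e⟩, hη, hE⟩ := exists_ext_represents rs hrs ω hreg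
  have hfin : Module.Finite R E := Module.Finite.equiv e
  have hrsE : ∀ r ∈ (⊥ : Ideal R) ⊔ Ideal.ofList rs, ∀ x : E, r • x = 0 := by
    intro r hr x
    rw [bot_sup_eq] at hr
    obtain ⟨x, rfl⟩ := e.surjective x
    obtain ⟨x, rfl⟩ := Submodule.Quotient.mk_surjective _ x
    rw [← map_smul, ← Submodule.Quotient.mk_smul,
      (Submodule.Quotient.mk_eq_zero _).mpr (Submodule.smul_mem_smul hr Submodule.mem_top), map_zero]
  have hmem : ∀ r ∈ rs, r ∈ (⊥ : Ideal R) ⊔ Ideal.ofList rs := fun r hr =>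
    Ideal.mem_sup_right (Ideal.subset_span hr)
  refine hE ⊥ (by simp) ?_
  -- Dimension equals depth for `ω`, so the quotient by a maximal regular sequence has dimension
  -- zero.
  obtain ⟨n, hn⟩ : ∃ n : ℕ, ∀ r ∈ maximalIdeal R ^ n, ∀ x : E, r • x = 0 := by
    refine exists_pow_smul_eq_zero_of_supportDim_eq_zero ?_
    rw [← Module.supportDim_eq_of_equiv e]
    have h := Module.supportDim_add_length_eq_supportDim_of_isRegular rs hreg
    rw [← hω.depth_eq, hdepth] at h
    revert h
    generalize Module.supportDim R (ω ⧸ (Ideal.ofList rs • ⊤ : Submodule R ω)) = a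
    intro h
    have hbot : a ≠ ⊥ := by rintro rfl; simp at h
    lift a to ℕ∞ using hbot
    norm_cast at h ⊢
    exact WithTop.add_right_cancel (WithTop.natCast_ne_top rs.length) (h.trans (zero_add _).symm)
  refine hasScalarEnd_of_extend hrsE ?_ ?_ hn
  · intro X Y _ _ _ _ _ _ hY f hf φ
    have hX : ∀ r ∈ rs, ∀ x : X, r • x = 0 := fun r hr x => hf (by
      rw [map_smul, hY r (hmem r hr), map_zero])
    -- Since `Ext^{d+1}(-, ω) = 0`, the functor `Ext^d(-, ω)` turns injections into surjections. By
    -- representability, maps into `E` extend.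
    obtain ⟨y, hy⟩ := ExtModule.pre_surjective (Y := ω) f (LinearMap.range f).mkQ hf
      (LinearMap.exact_map_mkQ_range f) (Submodule.mkQ_surjective _) rs.length
      (hd _ _ (by lia)) ((Abelian.Ext.mk₀ (ModuleCat.ofHom φ)).comp η (zero_add _))
    obtain ⟨ψ, rfl⟩ := (hη Y fun r hr => hY r (hmem r hr)).2 y
    refine ⟨ψ, (hη X hX).1 (Eq.trans ?_ hy)⟩
    simp [ExtModule.pre, ModuleCat.ofHom_comp]
  · obtain ⟨d, hd', ⟨s⟩⟩ := hω.type_one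
    obtain rfl : d = rs.length := by rw [hd'] at hdepth; exact_mod_cast hdepth
    have hb := hη (R ⧸ maximalIdeal R) fun r hr x => by
      obtain ⟨x, rfl⟩ := Submodule.Quotient.mk_surjective _ x
      rw [← Submodule.Quotient.mk_smul, Submodule.Quotient.mk_eq_zero]
      exact Ideal.mul_mem_right _ _ (hrs r hr)
    exact ⟨(LinearEquiv.ofBijective ((η.postcompOfLinear R _ (zero_add _)) ∘ₗ
      (ExtModule.zeroEquiv (R ⧸ maximalIdeal R) E).symm.toLinearMap) hb).trans s⟩

end Koszul
end

/-! ### Regular sequences on `Hom` modules, and maximal Cohen–Macaulay modules. -/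

noncomputable section

open IsLocalRing RingTheory.Sequence Pointwise

section RegularSequences

variable {R : Type u} [CommRing R]

/-- If `0 → A → B → C → 0` is exact, a weakly regular sequence on `B` which, except for its last
element, is weakly regular on `C` is weakly regular on `A`. -/
lemma isWeaklyRegular_of_dropLast (rs : List R) :
    ∀ {A B C : Type u} [AddCommGroup A] [Module R A] [AddCommGroup B] [Module R B]
      [AddCommGroup C] [Module R C] (f : A →ₗ[R] B) (g : B →ₗ[R] C), Function.Injective f →
      Function.Exact f g → Function.Surjective g → IsWeaklyRegular B rs →
      IsWeaklyRegular C rs.dropLast → IsWeaklyRegular A rs := by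
  induction rs with
  | nil => intros; exact IsWeaklyRegular.nil R _
  | cons r rs ih =>
    intro A B C _ _ _ _ _ _ f g hf hfg hg hB hC
    rw [isWeaklyRegular_cons_iff] at hB ⊢
    refine ⟨hB.1.of_injective f hf, ?_⟩
    cases rs with
    | nil => exact IsWeaklyRegular.nil R _
    | cons s rs =>
      rw [List.dropLast_cons_cons, isWeaklyRegular_cons_iff] at hC
      refine ih (QuotSMulTop.map r f) (QuotSMulTop.map r g) ?_ (QuotSMulTop.map_exact r hfg hg)
        (QuotSMulTop.map_surjective r hg) hB.2 hC.2
      -- `A/rA → B/rB` stays injective because `r` is regular on `C`. The last element of the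
      -- sequence is never divided out, hence need not be regular on `C`.
      rw [injective_iff_map_eq_zero]
      intro a ha
      obtain ⟨a, rfl⟩ := Submodule.Quotient.mk_surjective _ a
      have ha' := (Submodule.Quotient.mk_eq_zero _).mp
        (show (Submodule.Quotient.mk (f a) : QuotSMulTop r B) = 0 from ha)
      rw [Submodule.mem_smul_pointwise_iff_exists] at ha'
      obtain ⟨b, -, hb⟩ := ha'
      have hgb : g b = 0 := hC.1 (by
        change r • g b = r • (0 : C)
        rw [← map_smul, hb, smul_zero, hfg.apply_apply_eq_zero])
      obtain ⟨a', rfl⟩ := (hfg b).mp hgb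
      rw [← map_smul] at hb
      rw [← hf hb, Submodule.Quotient.mk_eq_zero]
      exact Submodule.smul_mem_pointwise_smul _ _ _ Submodule.mem_top

lemma isWeaklyRegular_of_injective_singleton {A B : Type u} [AddCommGroup A] [Module R A]
    [AddCommGroup B] [Module R B] (f : A →ₗ[R] B) (hf : Function.Injective f) {r : R}
    (h : IsWeaklyRegular B [r]) : IsWeaklyRegular A [r] := by
  rw [isWeaklyRegular_singleton_iff] at h ⊢
  exact h.of_injective f hf

lemma RingTheory.Sequence.IsWeaklyRegular.dropLast {N : Type u} [AddCommGroup N] [Module R N] {rs : List R}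
    (h : IsWeaklyRegular N rs) : IsWeaklyRegular N rs.dropLast := by
  rcases List.eq_nil_or_concat rs with rfl | ⟨l, a, rfl⟩
  · exact h
  · rw [List.concat_eq_append, isWeaklyRegular_append_iff] at h
    simpa using h.1

lemma isWeaklyRegular_hom_fin {N : Type u} [AddCommGroup N] [Module R N] {rs : List R}
    (h : IsWeaklyRegular N rs) (m : ℕ) : IsWeaklyRegular ((Fin m → R) →ₗ[R] N) rs :=
  (((TensorProduct.piScalarRight R R N (Fin m)).trans
    ((Pi.basisFun R (Fin m)).constr R)).isWeaklyRegular_congr rs).mp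
    (h.isWeaklyRegular_rTensor (M₂ := Fin m → R))

/-- If `Ext^j(M, N)` vanishes for `0 < j < rs.length`, a weakly regular sequence `rs` on `N` is
weakly regular on `Hom(M, N)`. -/
theorem isWeaklyRegular_hom [IsNoetherianRing R] {N : Type u} [AddCommGroup N] [Module R N]
    (t : ℕ) : ∀ (rs : List R), rs.length = t → IsWeaklyRegular N rs →
      ∀ (M : Type u) [AddCommGroup M] [Module R M] [Module.Finite R M],
      (∀ j, 1 ≤ j → j < t → Subsingleton (ExtModule R M N j)) →
      IsWeaklyRegular (M →ₗ[R] N) rs := by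
  induction t with
  | zero =>
    intro rs hrs _ M _ _ _ _
    rw [List.length_eq_zero_iff.mp hrs]
    exact IsWeaklyRegular.nil R _
  | succ t ih =>
    intro rs hrs hN M _ _ _ hM
    obtain ⟨m, g, hg⟩ := Module.Finite.exists_fin' R M
    have hB := isWeaklyRegular_hom_fin hN m
    have hinj : Function.Injective (LinearMap.lcomp R N g) :=
      LinearMap.lcomp_injective_of_surjective g hg
    have hex : Function.Exact (LinearMap.ker g).subtype g := LinearMap.exact_subtype_ker_map g
    have hker : Function.Injective (LinearMap.ker g).subtype := Submodule.injective_subtype _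
    cases t with
    | zero =>
      obtain ⟨r, rfl⟩ := List.length_eq_one_iff.mp hrs
      exact isWeaklyRegular_of_injective_singleton _ hinj hB
    | succ t =>
      -- `Ext^1(M, N) = 0` makes `0 → Hom(M, N) → N^m → Hom(ker g, N) → 0` exact. The syzygy loses
      -- one degree of vanishing, hence one element of the sequence.
      refine isWeaklyRegular_of_dropLast rs (LinearMap.lcomp R N g)
        (LinearMap.lcomp R N (LinearMap.ker g).subtype) hinj
        (LinearMap.exact_lcomp_of_exact_of_surjective N hex hg) ?_ hB
        (ih _ (by simp [hrs]) hN.dropLast _ ?_)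
      · intro φ
        obtain ⟨y, hy⟩ := ExtModule.pre_surjective (Y := N) _ g hker hex hg 0
          (hM 1 le_rfl (by lia)) ((ExtModule.zeroEquiv _ N).symm φ)
        refine ⟨ExtModule.zeroEquiv _ N y, ?_⟩
        have := ExtModule.zeroEquiv_pre (Y := N) (LinearMap.ker g).subtype y
        rw [hy, LinearEquiv.apply_symm_apply] at this
        exact this.symm
      · intro j hj hjt
        exact ExtModule.subsingleton_left _ g hker hex hg j
          (ExtModule.subsingleton_of_projective j hj) (hM (j + 1) (by lia) (by lia))

/-- A module with a weakly regular sequence of length `dim R` is maximal Cohen-Macaulay. -/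
theorem isMaximalCohenMacaulay_of_isWeaklyRegular [IsLocalRing R] [IsNoetherianRing R]
    {H : Type u} [AddCommGroup H] [Module R H] [Module.Finite R H] [Nontrivial H] {rs : List R}
    (hrs : ∀ r ∈ rs, r ∈ maximalIdeal R) (hreg : IsWeaklyRegular H rs)
    (hdim : ringKrullDim R = rs.length) : IsMaximalCohenMacaulay R H := by
  have hle : ∀ ss : List R, IsRegular H ss → (ss.length : WithBot ℕ∞) ≤ Module.supportDim R H := by
    intro ss hss
    rw [← Module.supportDim_add_length_eq_supportDim_of_isRegular ss hss]
    have := hss.quot_ofList_smul_nontrivial ⊤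
    have hbot := Module.supportDim_ne_bot_of_nontrivial R
      (H ⧸ (Ideal.ofList ss • ⊤ : Submodule R H))
    revert hbot
    generalize Module.supportDim R (H ⧸ (Ideal.ofList ss • ⊤ : Submodule R H)) = a
    intro ha
    lift a to ℕ∞ using ha
    norm_cast
    exact le_add_self
  have hreg' : IsRegular H rs :=
    (IsLocalRing.isRegular_iff_isWeaklyRegular_of_subset_maximalIdeal hrs).mpr hreg
  have hsupp : Module.supportDim R H = rs.length :=
    le_antisymm ((Module.supportDim_le_ringKrullDim R H).trans hdim.le) (hle rs hreg')
  have hdepth : moduleDepth R H = rs.length := by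
    refine le_antisymm (iSup_le fun ss => ?_) (length_le_moduleDepth hrs hreg')
    have := hle ss.1 ss.2.2
    rw [hsupp] at this
    exact_mod_cast this
  exact
    { nontrivial := inferInstance
      finite := inferInstance
      depth_eq := by rw [hdepth, hsupp]; rfl
      dim_eq := by rw [hsupp, hdim] }

lemma IsMaximalCohenMacaulay.moduleDepth_eq [IsLocalRing R] {H : Type u} [AddCommGroup H]
    [Module R H] (h : IsMaximalCohenMacaulay R H) {d : ℕ} (hd : ringKrullDim R = d) :
    moduleDepth R H = d := by
  have := h.depth_eq
  rw [h.dim_eq, hd] at this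
  exact_mod_cast this

/-- `M` surjects onto the residue field, and `k ⊗ N ≠ 0` by Nakayama. -/
lemma nontrivial_tensorProduct_of_isLocalRing [IsLocalRing R] {M N : Type u} [AddCommGroup M]
    [Module R M] [AddCommGroup N] [Module R N] [Module.Finite R M] [Module.Finite R N]
    [Nontrivial M] [Nontrivial N] : Nontrivial (M ⊗[R] N) := by
  obtain ⟨S, hS, -⟩ := (eq_top_or_exists_le_coatom (⊥ : Submodule R M)).resolve_left bot_ne_top
  obtain ⟨J, hJ, ⟨e⟩⟩ := isSimpleModule_iff_quot_maximal.mp (isSimpleModule_iff_isCoatom.mpr hS)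
  obtain rfl := IsLocalRing.eq_maximalIdeal hJ
  have hs : Function.Surjective (LinearMap.rTensor N (e.toLinearMap ∘ₗ S.mkQ)) :=
    LinearMap.rTensor_surjective N (e.surjective.comp S.mkQ_surjective)
  have : Nontrivial ((R ⧸ maximalIdeal R) ⊗[R] N) := by
    by_contra h
    rw [not_nontrivial_iff_subsingleton] at h
    exact not_subsingleton N (IsLocalRing.subsingleton_tensorProduct.mp h)
  exact hs.nontrivial

end RegularSequences
end

/-! ### Assembly of the theorem. -/

theorem mainTheorem1 {R : Type u} [CommRing R] [IsLocalRing R]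
    (hR : IsCohenMacaulayLocalRing R) (d : ℕ) (hd : ringKrullDim R = d)
    {ω : Type u} [AddCommGroup ω] [Module R ω] (hω : IsCanonicalModule R ω)
    {M N : Type u} [AddCommGroup M] [Module R M] [Module.Finite R M]
    [AddCommGroup N] [Module R N] (hN : IsMaximalCohenMacaulay R N) (n : ℕ) :
    -- (i)
    ((∀ j : ℕ, 1 ≤ j → j ≤ d → Subsingleton (ExtModule R M N j)) →
      Nonempty ((M ⊗[R] CanonicalDual R ω N) ≃ₗ[R] CanonicalDual R ω (M →ₗ[R] N)) ∧
      (Nontrivial M →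
        IsMaximalCohenMacaulay R (M ⊗[R] CanonicalDual R ω N) ∧
        IsMaximalCohenMacaulay R (M →ₗ[R] N))) ∧
    -- (ii)
    ((∀ j : ℕ, 1 ≤ j → j ≤ d + n → Subsingleton (ExtModule R M N j)) →
      Nonempty (ExtModule R (ExtModule R M N (d + n + 1)) ω d ≃ₗ[R]
        TorModule R M (CanonicalDual R ω N) (n + 1)) ∧
      (∀ i : ℕ, 1 ≤ i → i ≤ n → Subsingleton (TorModule R M (CanonicalDual R ω N) i)) ∧
      ∃ (f₁ : TorModule R M (CanonicalDual R ω N) (n + 3) →ₗ[R]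
            extInt R (ExtModule R M N (d + n + 1)) ω ((d : ℤ) - 2))
        (f₂ : extInt R (ExtModule R M N (d + n + 1)) ω ((d : ℤ) - 2) →ₗ[R]
            ExtModule R (ExtModule R M N (d + n + 2)) ω d)
        (f₃ : ExtModule R (ExtModule R M N (d + n + 2)) ω d →ₗ[R]
            TorModule R M (CanonicalDual R ω N) (n + 2))
        (f₄ : TorModule R M (CanonicalDual R ω N) (n + 2) →ₗ[R]
            extInt R (ExtModule R M N (d + n + 1)) ω ((d : ℤ) - 1)),
        Function.Exact f₁ f₂ ∧ Function.Exact f₂ f₃ ∧ Function.Exact f₃ f₄ ∧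
          Function.Surjective f₄) ∧
    -- (iii)
    ((∀ j : ℕ, 1 ≤ j → j ≤ d + n → Subsingleton (TorModule R M (CanonicalDual R ω N) j)) →
      Nonempty (CanonicalDual R ω (TorModule R M (CanonicalDual R ω N) (d + n + 1)) ≃ₗ[R]
        ExtModule R M N (d + n + 1)) ∧
      (∀ i : ℕ, i ≤ d →
        Nonempty (ExtModule R (M ⊗[R] CanonicalDual R ω N) ω i ≃ₗ[R] ExtModule R M N i)) ∧
      (∀ k : ℕ, d + 1 ≤ k → k ≤ d + n → Subsingleton (ExtModule R M N k)) ∧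
      ∃ (g₁ : ExtModule R (TorModule R M (CanonicalDual R ω N) (d + n + 1)) ω 1 →ₗ[R]
            ExtModule R M N (d + n + 2))
        (g₂ : ExtModule R M N (d + n + 2) →ₗ[R]
            CanonicalDual R ω (TorModule R M (CanonicalDual R ω N) (d + n + 2)))
        (g₃ : CanonicalDual R ω (TorModule R M (CanonicalDual R ω N) (d + n + 2)) →ₗ[R]
            ExtModule R (TorModule R M (CanonicalDual R ω N) (d + n + 1)) ω 2)
        (g₄ : ExtModule R (TorModule R M (CanonicalDual R ω N) (d + n + 1)) ω 2 →ₗ[R]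
            ExtModule R M N (d + n + 3)),
        Function.Injective g₁ ∧ Function.Exact g₁ g₂ ∧ Function.Exact g₂ g₃ ∧
          Function.Exact g₃ g₄) := by
  have := hR.noetherian
  have := hω.finite
  have := hω.nontrivial
  have := hN.finite
  have := hN.nontrivial
  have hRd : moduleDepth R R = d := by
    have := hR.cohenMacaulay.depth_eq
    rw [Module.supportDim_self_eq_ringKrullDim, hd] at this
    exact_mod_cast this
  have hid := subsingleton_ext_of_depth_lt hRd hω.finite_injectiveDimension
  have hωd := hω.toIsMaximalCohenMacaulay.moduleDepth_eq hd
  obtain ⟨ws, hwlen, hws, hwreg⟩ := exists_isRegular_of_moduleDepth_eq hωd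
  obtain ⟨rs, hrlen, hrs, hrreg⟩ := exists_isRegular_of_moduleDepth_eq (hN.moduleDepth_eq hd)
  have hωω : ∀ p, 1 ≤ p → Subsingleton (ExtModule R ω ω p) := fun p hp =>
    ExtModule.subsingleton_of_isWeaklyRegular hid ws hws ω hwreg.1 p (by lia)
  have hNω : ∀ p, 1 ≤ p → Subsingleton (ExtModule R N ω p) := fun p hp =>
    ExtModule.subsingleton_of_isWeaklyRegular hid rs hrs N hrreg.1 p (by lia)
  have hdual : ∀ (X : Type u) [AddCommGroup X] [Module R X] [Module.Finite R X],
      (∀ p, 1 ≤ p → Subsingleton (ExtModule R X ω p)) → RingTheory.Sequence.IsWeaklyRegular (X →ₗ[R] ω) ws :=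
    fun X _ _ _ hX => isWeaklyRegular_hom d ws hwlen hwreg.1 X fun j hj _ => hX j hj
  have hfin : ∀ (X Y : Type u) [AddCommGroup X] [Module R X] [Module.Finite R X]
      [AddCommGroup Y] [Module R Y] [Module.Finite R Y], Module.Finite R (X →ₗ[R] Y) :=
    fun X Y _ _ _ _ _ _ => inferInstance
  have hNdω : ∀ p, 1 ≤ p → Subsingleton (ExtModule R (N →ₗ[R] ω) ω p) := fun p hp =>
    ExtModule.subsingleton_of_isWeaklyRegular hid ws hws _ (hdual N hNω) p (by lia)
  -- Biduality is the isomorphism of part (i) for the pair `(N, ω)`, combined with `End ω ≅ R`.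
  obtain ⟨eN⟩ : Nonempty (((N →ₗ[R] ω) →ₗ[R] ω) ≃ₗ[R] N) := by
    obtain ⟨e₁⟩ := ExtModule.nonempty_tensor_dual_equiv hid hωω (M := N)
      fun j hj _ => hNω j hj
    obtain ⟨e₂⟩ := (hω.hasScalarEnd hωd hid).nonempty_equiv
    exact ⟨e₁.symm.trans ((TensorProduct.congr (LinearEquiv.refl R N) e₂.symm).trans
      (TensorProduct.rid R N))⟩
  refine ⟨fun hMN => ?_, fun hMN => ExtModule.tor_of_subsingleton_ext hid hNω n hMN,
    fun hMN => ExtModule.ext_of_subsingleton_tor hid hNdω eN n hMN⟩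
  obtain ⟨e⟩ := ExtModule.nonempty_tensor_dual_equiv hid hNω hMN
  refine ⟨⟨e⟩, fun hM => ?_⟩
  have hNd : Nontrivial (N →ₗ[R] ω) := by
    by_contra h
    rw [not_nontrivial_iff_subsingleton] at h
    exact not_subsingleton N eN.symm.toEquiv.subsingleton
  have hT : Nontrivial (M ⊗[R] (N →ₗ[R] ω)) := nontrivial_tensorProduct_of_isLocalRing
  have hHreg : RingTheory.Sequence.IsWeaklyRegular (M →ₗ[R] N) rs :=
    isWeaklyRegular_hom d rs hrlen hrreg.1 M fun j hj hjd => hMN j hj hjd.le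
  have hHnt : Nontrivial (M →ₗ[R] N) := by
    by_contra h
    rw [not_nontrivial_iff_subsingleton] at h
    exact not_subsingleton (M ⊗[R] (N →ₗ[R] ω)) e.toEquiv.subsingleton
  refine ⟨?_, isMaximalCohenMacaulay_of_isWeaklyRegular hrs hHreg (by rw [hd, hrlen])⟩
  -- `M ⊗ N†` is the dual of `Hom(M, N)`. The latter carries a regular sequence of length `d`, so it
  -- has no higher `Ext` into `ω`, and a regular sequence on `ω` is regular on its dual.
  refine isMaximalCohenMacaulay_of_isWeaklyRegular hws
    ((e.isWeaklyRegular_congr ws).mpr (hdual _ fun p hp => ?_)) (by rw [hd, hwlen])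
  exact ExtModule.subsingleton_of_isWeaklyRegular hid rs hrs _ hHreg p (by lia)
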